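/- **Conventions.** Polynomial time means time polynomial in the input length on a deterministic multi-stack (equivalently, multi-tape) Turing machine; tuples of strings are encoded with end markers. A *family of efficiently sampleable distributions* $D=(D_n)_{n\in\mathbb N}$ consists of a polynomial seed length $\ell(n)$ and a polynomial-time algorithm that maps $1^n$ and a seed $r\in\{0,1\}^{\ell(n)}$ to a string $D_n(r)\in\{0,1\}^n$; the seed is uniformly random. A *non-uniform randomized polynomial-time algorithm* $A$ receives, besides its input for the parameter $n$, an advice string $a_n$ of length polynomial in $n$ (depending only on $n$) and polynomially many uniformly random bits $\rho$, and runs in polynomial time. Let $L\subseteq\{0,1\}^*$ be a language. The pair $(L,D)$ is *hard on average (non-uniformly, with public coins)* if for every non-uniform randomized polynomial-time algorithm $A$, which is given both the instance and the seed that generated it, and for every $c\in\mathbb N$, for all sufficiently large $n$, $$\Pr_{r,\rho}\big[A(a_n,r,D_n(r),\rho)\text{ correctly decides whether } D_n(r)\in L\big]<\tfrac12+n^{-c}.$$ A *search problem* is a relation $R\subseteq\{0,1\}^*\times\{0,1\}^*$. It belongs to $\mathsf{TFNP}/\mathrm{poly}$ if there are a polynomial $q$, a polynomial-time verifier $V$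 and advice strings $(b_m)_{m\in\mathbb N}$ of length polynomial in $m$ such that $(x,w)\in R$ if and only if $|w|\le q(|x|)$ and $V(b_{|x|},x,w)$ accepts, and for every $x$ there is a $w$ with $(x,w)\in R$. The pair $(R,D)$ is *hard on average (non-uniformly, with public coins)* if for every non-uniform randomized polynomial-time algorithm $A$ and every $c\in\mathbb N$, for all sufficiently large $n$, $$\Pr_{r,\rho}\big[(D_n(r),\,A(a_n,r,D_n(r),\rho))\in R\big]<n^{-c}.$$ **Theorem 4.2** (Hubáček–Naor–Yogev; non-uniform, public-coin version). If there are a language $L\in\mathsf{NP}$ and a family $D$ of efficiently sampleable distributions such that $(L,D)$ is hard on average (non-uniformly, with public coins), then there are a search problem $R\in\mathsf{TFNP}/\mathrm{poly}$ and a family $D'$ of efficiently sampleable distributions such that $(R,D')$ is hard on average (non-uniformly, with public coins). -/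

import Mathlib

namespace AvgHard

/-- Encoding of a `k`-tuple of bit strings over the three-letter alphabet `{0, 1, none}`:
each string is followed by the end marker `none`. -/
def encodeTuple {k : ℕ} (v : Fin k → List Bool) : List (Option Bool) :=
  (List.ofFn v).flatMap fun x => x.map some ++ [none]

/-- The function `f` on `k`-tuples of bit strings is computed by a (deterministic, multi-stack)
Turing machine in time polynomial in the length of the encoded input. -/
def PolyTime {k : ℕ} (f : (Fin k → List Bool) → List Bool) : Prop :=
  Nonempty (Turing.TM2ComputableInPolyTime (encodeTuple (k := k)) (id : List Bool → List Bool) f)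

/-- Advice strings of polynomial length, one for each `n`. -/
def PolyAdvice (a : ℕ → List Bool) : Prop :=
  ∃ q : Polynomial ℕ, ∀ n, (a n).length ≤ q.eval n

/-- The class NP: `x ∈ L` iff there is a witness of polynomial length that is accepted
(output `[true]`) by a fixed polynomial-time verifier. -/
def InNP (L : Language Bool) : Prop :=
  ∃ (V : (Fin 2 → List Bool) → List Bool) (q : Polynomial ℕ), PolyTime V ∧
    ∀ x, x ∈ L ↔ ∃ w : List Bool, w.length ≤ q.eval x.length ∧ V ![x, w] = [true]

/-- The class TFNP/poly of total search problems, `R x w` meaning that `w` is a solution (witness)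
for the instance `x`: solutions have polynomial length and are recognized by a fixed
polynomial-time verifier with polynomial-length advice, the advice depending only on the length of
the instance; and every instance has a solution. -/
def InTFNPPoly (R : List Bool → List Bool → Prop) : Prop :=
  (∃ (V : (Fin 3 → List Bool) → List Bool) (a : ℕ → List Bool) (q : Polynomial ℕ),
    PolyTime V ∧ PolyAdvice a ∧
    ∀ x w, R x w ↔ w.length ≤ q.eval x.length ∧ V ![a x.length, x, w] = [true]) ∧
  ∀ x, ∃ w, R x w

/-- An efficiently sampleable family of distributions `D n` on strings of length `n`: there is a
(uniform) polynomial-time algorithm that maps `1ⁿ` and a uniformly random seed, of length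
polynomial in `n`, to a string of length `n`. -/
structure Sampler where
  seedLen : Polynomial ℕ
  sample : (Fin 2 → List Bool) → List Bool
  polyTime : PolyTime sample
  length_sample : ∀ (n : ℕ) (r : List Bool), r.length = seedLen.eval n →
    (sample ![List.replicate n true, r]).length = n

/-- The string `D n r` that the sampler produces from the seed `r`. -/
def Sampler.draw (D : Sampler) (n : ℕ) (r : Fin (D.seedLen.eval n) → Bool) : List Bool :=
  D.sample ![List.replicate n true, List.ofFn r]

open scoped Classical in
/-- Probability of the event `E` under the uniform distribution on the finite type `Ω`. -/
noncomputable def prob {Ω : Type} [Fintype Ω] (E : Ω → Prop) : ℝ :=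
  ((Finset.univ.filter E).card : ℝ) / (Fintype.card Ω : ℝ)

/-- `(L, D)` is hard on average, with public coins, against non-uniform algorithms.
An algorithm `A` receives advice `a n`, the seed `r` (the public coins), the instance `D n r`, and
its own random bits; it answers "yes" by the output `[true]` and "no" by any other output.
For no polynomial is its advantage over random guessing at least the inverse of this polynomial
infinitely often. -/
def HardLanguage (L : Language Bool) (D : Sampler) : Prop :=
  ∀ (A : (Fin 4 → List Bool) → List Bool) (a : ℕ → List Bool) (coins : Polynomial ℕ),
    PolyTime A → PolyAdvice a →
    ∀ c : ℕ, ∀ᶠ n : ℕ in Filter.atTop,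
      prob (fun ω : (Fin (D.seedLen.eval n) → Bool) × (Fin (coins.eval n) → Bool) =>
        (A ![a n, List.ofFn ω.1, D.draw n ω.1, List.ofFn ω.2] = [true] ↔ D.draw n ω.1 ∈ L))
      < 1 / 2 + 1 / (n : ℝ) ^ c

/-- The search problem `R` with the distributions `D` on its instances is hard on average, with
public coins, against non-uniform algorithms: every such algorithm finds a solution with
negligible probability only. -/
def HardSearch (R : List Bool → List Bool → Prop) (D : Sampler) : Prop :=
  ∀ (A : (Fin 4 → List Bool) → List Bool) (a : ℕ → List Bool) (coins : Polynomial ℕ),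
    PolyTime A → PolyAdvice a →
    ∀ c : ℕ, ∀ᶠ n : ℕ in Filter.atTop,
      prob (fun ω : (Fin (D.seedLen.eval n) → Bool) × (Fin (coins.eval n) → Bool) =>
        R (D.draw n ω.1) (A ![a n, List.ofFn ω.1, D.draw n ω.1, List.ofFn ω.2]))
      < 1 / (n : ℝ) ^ c

end AvgHard

/-! Let `n` be a parameter with seed length `ℓ`. Always answering "no" must fail, so for large `n`
at least a quarter of the seeds produce elements of `L` (`HardLanguage.density`). A set of that
density has `3 * (ℓ + 1)` translates under bitwise exclusive or that cover the cube `{0,1}^ℓ`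
(`exists_cover`). With these shifts as advice of the verifier, the search problem is: given a string
`x`, find a shift `s` and an NP witness for the instance of `L` generated by the seed `r`, the first
`ℓ` bits of `x ⊕ s`. Covering makes it total.

The instances `x` are uniform, so seed and instance coincide. Suppose that `A` solves the problem
with noticeable probability. The mask that turns `r` into `x` is determined by the position of the
shift in the advice and by the bits of `x` beyond `ℓ`. There are few positions, so by pigeonhole
(`exists_fiber`) one mask `u` and one choice of coins work for a noticeable fraction of all seeds
`r`: run on `u ⊕ r`, `A` returns a witness for the instance of `r`. The decider for `L` computes `u
⊕ r`, which it can do because the coins are public. It answers "yes" if it obtains a witness and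
otherwise gives the better constant answer (`exists_constant_answer`). Witnesses never lie, so half
of that fraction is advantage (`exists_advice_shiftDecider`), against the hardness of `L`.

An instance length `m` is served by the parameter `seedParam ℓ m`, and the two are polynomially
related (`le_eval_seedParam`). Verifier and decider must run in polynomial time on stack machines.
This reduces to closure under composition (`PolyTime.comp`), finite-state transducers
(`polyTime_of_transduce`) and symbolwise combination of two strings (`polyTime_zipBits`). -/

namespace AvgHard

/-! ### Stack programs: simulation inside larger machines, sequencing, growth of stacks. -/

open Turing Turing.TM2

/-- `RunsIn f n a b`: iterating the partial step function `f` exactly `n` times leads from `a`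
to `b`. -/
def RunsIn {α : Type} (f : α → Option α) : ℕ → α → α → Prop
  | 0, a, b => a = b
  | n + 1, a, b => ∃ c, f a = some c ∧ RunsIn f n c b

theorem RunsIn.trans {α : Type} {f : α → Option α} {m n : ℕ} {a b c : α}
    (h₁ : RunsIn f m a b) (h₂ : RunsIn f n b c) : RunsIn f (m + n) a c := by
  induction m generalizing a with
  | zero => cases h₁; simpa using h₂
  | succ m ih =>
    obtain ⟨d, hd, h⟩ := h₁
    rw [Nat.succ_add]
    exact ⟨d, hd, ih h⟩

theorem iterate_bind_none {α : Type} (f : α → Option α) (n : ℕ) :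
    (flip bind f)^[n] (none : Option α) = none := by
  induction n with
  | zero => rfl
  | succ n ih => rw [Function.iterate_succ_apply]; exact ih

/-- The right side is the form of evaluation used by `TM2ComputableInPolyTime`; the left side is the
one suited to induction along a run. -/
theorem runsIn_iff_iterate {α : Type} {f : α → Option α} {n : ℕ} {a b : α} :
    RunsIn f n a b ↔ (flip bind f)^[n] (some a) = some b := by
  induction n generalizing a with
  | zero => simp [RunsIn]
  | succ n ih =>
    rw [Function.iterate_succ_apply]
    have e : flip bind f (some a) = f a := rfl
    rw [e]
    cases h : f a with
    | none => rw [iterate_bind_none]; simp [RunsIn, h]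
    | some c => simp [RunsIn, h, ih]

/-- A program acting on the stacks `Γ`, with its own labels and internal states, meant to be
combined with other programs acting on the same stacks. -/
structure Fragment {K : Type} (Γ : K → Type) where
  Λ : Type
  [finΛ : Fintype Λ]
  main : Λ
  σ : Type
  [finσ : Fintype σ]
  init : σ
  m : Λ → Stmt Γ Λ σ

attribute [instance] Fragment.finΛ Fragment.finσ

namespace Fragment

variable {K K' : Type} {Γ : K → Type} {Γ' : K' → Type}

/-- The fragment `P` turns the stacks `S` into the stacks `S'` within `t` steps, and restores its
internal state. -/
def Runs [DecidableEq K] (P : Fragment Γ) (S S' : ∀ k, List (Γ k)) (t : ℕ) : Prop :=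
  ∃ n ≤ t, RunsIn (step P.m) n ⟨some P.main, P.init, S⟩ ⟨none, P.init, S'⟩

theorem Runs.mono [DecidableEq K] {P : Fragment Γ} {S S' : ∀ k, List (Γ k)} {t t' : ℕ}
    (h : P.Runs S S' t) (htt : t ≤ t') : P.Runs S S' t' := by
  obtain ⟨n, hn, h⟩ := h
  exact ⟨n, hn.trans htt, h⟩

/-- Translation of a statement to a machine with more stacks, states and labels; halting becomes a
jump to `exit`. -/
def embedStmt {Λ Λ' σ σ' : Type} (e : K → K') (ι : ∀ k, Γ k ≃ Γ' (e k)) (get : σ' → σ)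
    (set : σ → σ' → σ') (emb : Λ → Λ') (exit : Option Λ') : Stmt Γ Λ σ → Stmt Γ' Λ' σ'
  | .push k f q => .push (e k) (fun s => ι k (f (get s))) (embedStmt e ι get set emb exit q)
  | .peek k f q => .peek (e k) (fun s o => set (f (get s) (o.map (ι k).symm)) s)
      (embedStmt e ι get set emb exit q)
  | .pop k f q => .pop (e k) (fun s o => set (f (get s) (o.map (ι k).symm)) s)
      (embedStmt e ι get set emb exit q)
  | .load f q => .load (fun s => set (f (get s)) s) (embedStmt e ι get set emb exit q)
  | .branch f q₁ q₂ => .branch (fun s => f (get s)) (embedStmt e ι get set emb exit q₁)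
      (embedStmt e ι get set emb exit q₂)
  | .goto l => .goto fun s => emb (l (get s))
  | .halt => exit.elim .halt fun l => .goto fun _ => l

/-- The stacks `S'` are the stacks `S` along `e`, and agree with `B` elsewhere. -/
def Sim (e : K → K') (ι : ∀ k, Γ k ≃ Γ' (e k)) (B : ∀ j, List (Γ' j)) (S : ∀ k, List (Γ k))
    (S' : ∀ j, List (Γ' j)) : Prop :=
  (∀ k, S' (e k) = (S k).map (ι k)) ∧ ∀ j, (∀ k, e k ≠ j) → S' j = B j

theorem Sim.unique {e : K → K'} {ι : ∀ k, Γ k ≃ Γ' (e k)} {B : ∀ j, List (Γ' j)}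
    {S : ∀ k, List (Γ k)} {S₁ S₂ : ∀ j, List (Γ' j)} (h₁ : Sim e ι B S S₁)
    (h₂ : Sim e ι B S S₂) : S₁ = S₂ := by
  funext j
  by_cases h : ∃ k, e k = j
  · obtain ⟨k, rfl⟩ := h
    rw [h₁.1, h₂.1]
  · push Not at h
    rw [h₁.2 j h, h₂.2 j h]

theorem Sim.update [DecidableEq K] [DecidableEq K'] {e : K → K'} (he : Function.Injective e)
    {ι : ∀ k, Γ k ≃ Γ' (e k)} {B : ∀ j, List (Γ' j)} {S : ∀ k, List (Γ k)}
    {S' : ∀ j, List (Γ' j)} (h : Sim e ι B S S') (k : K) (l : List (Γ k)) :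
    Sim e ι B (Function.update S k l) (Function.update S' (e k) (l.map (ι k))) := by
  constructor
  · intro k'
    by_cases hk : k' = k
    · subst hk; simp
    · rw [Function.update_of_ne (he.ne hk), Function.update_of_ne hk, h.1]
  · intro j hj
    rw [Function.update_of_ne (hj k).symm, h.2 j hj]

/-- `get` and `set` single out one component of the host state, and `hgs`, `hss` are what is needed
for the statement to act on that component only. A jump to `exit` replaces halting within the same
step, so the simulation costs no extra time. -/
theorem stepAux_embedStmt [DecidableEq K] [DecidableEq K'] {Λ Λ' σ σ' : Type} {e : K → K'}
    (he : Function.Injective e) {ι : ∀ k, Γ k ≃ Γ' (e k)} {get : σ' → σ} {set : σ → σ' → σ'}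
    (hgs : ∀ a s, get (set a s) = a) (hss : ∀ a b s, set a (set b s) = set a s)
    (emb : Λ → Λ') (exit : Option Λ') (B : ∀ j, List (Γ' j)) (s₀ : σ') (q : Stmt Γ Λ σ) (a : σ)
    (S : ∀ k, List (Γ k)) (S' : ∀ j, List (Γ' j)) (h : Sim e ι B S S') :
    ∃ T', Sim e ι B (stepAux q a S).stk T' ∧
      stepAux (embedStmt e ι get set emb exit q) (set a s₀) S' =
        ⟨(stepAux q a S).l.elim exit (some ∘ emb), set (stepAux q a S).var s₀, T'⟩ := by
  induction q generalizing a S S' with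
  | push k f q ih =>
    simp only [embedStmt, stepAux, hgs]
    have := h.update he k (f a :: S k)
    rw [List.map_cons, ← h.1] at this
    exact ih _ _ _ this
  | peek k f q ih =>
    simp only [embedStmt, stepAux, hgs, hss, h.1, List.head?_map, Option.map_map]
    simpa using ih (f a (S k).head?) _ _ h
  | pop k f q ih =>
    simp only [embedStmt, stepAux, hgs, hss, h.1, List.head?_map, Option.map_map]
    have := h.update he k (S k).tail
    rw [List.map_tail] at this
    simpa using ih (f a (S k).head?) _ _ this
  | load f q ih =>
    simp only [embedStmt, stepAux, hgs, hss]
    exact ih _ _ _ h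
  | branch f q₁ q₂ ih₁ ih₂ =>
    simp only [embedStmt, stepAux, hgs]
    cases f a
    · exact ih₂ _ _ _ h
    · exact ih₁ _ _ _ h
  | goto l =>
    simp only [embedStmt, stepAux, hgs]
    exact ⟨_, h, rfl⟩
  | halt =>
    cases exit <;> exact ⟨_, h, rfl⟩

/-- A run of a program is simulated by any machine that contains the translated program. -/
theorem runsIn_embedStmt [DecidableEq K] [DecidableEq K'] {Λ Λ' σ σ' : Type} {e : K → K'}
    (he : Function.Injective e) {ι : ∀ k, Γ k ≃ Γ' (e k)} {get : σ' → σ} {set : σ → σ' → σ'}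
    (hgs : ∀ a s, get (set a s) = a) (hss : ∀ a b s, set a (set b s) = set a s)
    {emb : Λ → Λ'} {exit : Option Λ'} (B : ∀ j, List (Γ' j)) (s₀ : σ')
    {m : Λ → Stmt Γ Λ σ} {m' : Λ' → Stmt Γ' Λ' σ'}
    (hm : ∀ l, m' (emb l) = embedStmt e ι get set emb exit (m l)) {n : ℕ} {c d : Cfg Γ Λ σ}
    (h : RunsIn (step m) n c d) (hd : d.l = none) (S' : ∀ j, List (Γ' j))
    (hS : Sim e ι B c.stk S') :
    ∃ T', Sim e ι B d.stk T' ∧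
      RunsIn (step m') n ⟨c.l.elim exit (some ∘ emb), set c.var s₀, S'⟩
        ⟨exit, set d.var s₀, T'⟩ := by
  induction n generalizing c S' with
  | zero =>
    cases h
    refine ⟨S', hS, ?_⟩
    rw [hd]
    rfl
  | succ n ih =>
    obtain ⟨x, hx, h⟩ := h
    obtain ⟨_ | l, v, S⟩ := c
    · simp at hx
    · simp only [step, Option.some.injEq] at hx
      obtain ⟨T₁, hT₁, e₁⟩ := stepAux_embedStmt he hgs hss emb exit B s₀ (m l) v S S' hS
      rw [hx] at hT₁ e₁
      obtain ⟨T', hT', r⟩ := ih h T₁ hT₁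
      refine ⟨T', hT', _, ?_, r⟩
      simp [hm, e₁]

/-- Running two programs one after the other. -/
def seq (P Q : Fragment Γ) : Fragment Γ where
  Λ := P.Λ ⊕ Q.Λ
  main := .inl P.main
  σ := P.σ × Q.σ
  init := (P.init, Q.init)
  m := Sum.elim
    (fun l => embedStmt id (fun _ => Equiv.refl _) Prod.fst (fun a s => (a, s.2)) Sum.inl
      (some (Sum.inr Q.main)) (P.m l))
    (fun l => embedStmt id (fun _ => Equiv.refl _) Prod.snd (fun a s => (s.1, a)) Sum.inr
      none (Q.m l))

/-- `P` restores its half of the state and leaves that of `Q` untouched, so `Q` starts in `Q.init`;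
the times add up exactly. -/
theorem Runs.seq [DecidableEq K] {P Q : Fragment Γ} {S T U : ∀ k, List (Γ k)} {t u : ℕ}
    (hP : P.Runs S T t) (hQ : Q.Runs T U u) : (P.seq Q).Runs S U (t + u) := by
  obtain ⟨m, hm, hP⟩ := hP
  obtain ⟨n, hn, hQ⟩ := hQ
  refine ⟨m + n, add_le_add hm hn, ?_⟩
  have r₁ := runsIn_embedStmt (e := id) (ι := fun k => Equiv.refl (Γ k))
    (m' := (P.seq Q).m) (emb := Sum.inl) (exit := some (Sum.inr Q.main))
    (get := Prod.fst) (set := fun a s => (a, s.2)) Function.injective_id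
    (fun _ _ => rfl) (fun _ _ _ => rfl) S (P.init, Q.init) (fun _ => rfl) hP rfl S
    ⟨fun k => by simp, fun _ _ => rfl⟩
  obtain ⟨T₁, h₁, r₁⟩ := r₁
  have r₂ := runsIn_embedStmt (e := id) (ι := fun k => Equiv.refl (Γ k))
    (m' := (P.seq Q).m) (emb := Sum.inr) (exit := none)
    (get := Prod.snd) (set := fun a s => (s.1, a)) Function.injective_id
    (fun _ _ => rfl) (fun _ _ _ => rfl) T (P.init, Q.init) (fun _ => rfl) hQ rfl T
    ⟨fun k => by simp, fun _ _ => rfl⟩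
  obtain ⟨T₂, h₂, r₂⟩ := r₂
  have e₁ : T₁ = T := funext fun k => by simpa using h₁.1 k
  have e₂ : T₂ = U := funext fun k => by simpa using h₂.1 k
  subst e₁ e₂
  exact r₁.trans r₂

/-- Running a program on some of the stacks of a larger machine. -/
def lift (P : Fragment Γ) (e : K → K') (ι : ∀ k, Γ k ≃ Γ' (e k)) : Fragment Γ' where
  Λ := P.Λ
  main := P.main
  σ := P.σ
  init := P.init
  m l := embedStmt e ι id (fun a _ => a) id none (P.m l)

theorem Runs.lift [DecidableEq K] [DecidableEq K'] {P : Fragment Γ} {S T : ∀ k, List (Γ k)}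
    {t : ℕ} (h : P.Runs S T t) {e : K → K'} (he : Function.Injective e)
    (ι : ∀ k, Γ k ≃ Γ' (e k)) {S' T' : ∀ j, List (Γ' j)} (hS : ∀ k, S' (e k) = (S k).map (ι k))
    (hT : ∀ k, T' (e k) = (T k).map (ι k)) (hST : ∀ j, (∀ k, e k ≠ j) → T' j = S' j) :
    (P.lift e ι).Runs S' T' t := by
  obtain ⟨n, hn, h⟩ := h
  obtain ⟨T₁, h₁, r⟩ := runsIn_embedStmt (m' := (P.lift e ι).m) (get := id)
    (set := fun a _ => a) he (fun _ _ => rfl) (fun _ _ _ => rfl) S' P.init (fun _ => rfl) h rfl S'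
    ⟨hS, fun _ _ => rfl⟩
  have : T' = T₁ := Sim.unique (B := S') ⟨hT, hST⟩ h₁
  subst this
  exact ⟨n, hn, r⟩

/-- The largest number of symbols that a statement can push. -/
def pushes {Λ σ : Type} : Stmt Γ Λ σ → ℕ
  | .push _ _ q => pushes q + 1
  | .peek _ _ q => pushes q
  | .pop _ _ q => pushes q
  | .load _ q => pushes q
  | .branch _ q₁ q₂ => max (pushes q₁) (pushes q₂)
  | .goto _ => 0
  | .halt => 0

theorem length_stepAux_le [DecidableEq K] {Λ σ : Type} (q : Stmt Γ Λ σ) (a : σ)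
    (S : ∀ k, List (Γ k)) (k : K) :
    ((stepAux q a S).stk k).length ≤ (S k).length + pushes q := by
  induction q generalizing a S with
  | push k' f q ih =>
    refine (ih _ _).trans ?_
    by_cases h : k = k'
    · subst h; simp [pushes]; omega
    · rw [Function.update_of_ne h]; simp [pushes]
  | peek k' f q ih => exact ih _ _
  | pop k' f q ih =>
    refine (ih _ _).trans ?_
    by_cases h : k = k'
    · subst h; simp [pushes]
    · rw [Function.update_of_ne h]; simp [pushes]
  | load f q ih => exact ih _ _
  | branch f q₁ q₂ ih₁ ih₂ =>
    simp only [stepAux, pushes]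
    cases f a
    · exact (ih₂ _ _).trans (by simp)
    · exact (ih₁ _ _).trans (by simp)
  | goto l => simp [stepAux]
  | halt => simp [stepAux]

/-- The sum over all labels is a crude bound for the symbols pushed in one step. It makes the output
length polynomial whenever the time is. -/
theorem Runs.length_le [DecidableEq K] {P : Fragment Γ} {S T : ∀ k, List (Γ k)} {t : ℕ}
    (h : P.Runs S T t) (k : K) :
    (T k).length ≤ (S k).length + (∑ l, pushes (P.m l)) * t := by
  obtain ⟨n, hn, h⟩ := h
  have key : ∀ (n : ℕ) (c d : Cfg Γ P.Λ P.σ), RunsIn (step P.m) n c d →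
      (d.stk k).length ≤ (c.stk k).length + (∑ l, pushes (P.m l)) * n := by
    intro n
    induction n with
    | zero => rintro c d ⟨⟩; simp
    | succ n ih =>
      rintro c d ⟨x, hx, h⟩
      obtain ⟨_ | l, v, S⟩ := c
      · simp at hx
      · simp only [step, Option.some.injEq] at hx
        have h₁ := ih _ _ h
        have h₂ := length_stepAux_le (P.m l) v S k
        rw [hx] at h₂
        have h₃ : pushes (P.m l) ≤ ∑ l, pushes (P.m l) :=
          Finset.single_le_sum (f := fun l => pushes (P.m l)) (fun _ _ => Nat.zero_le _)
            (Finset.mem_univ l)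
        rw [Nat.mul_succ]
        simp only
        omega
  exact (key _ _ _ h).trans (by simpa using Nat.mul_le_mul_left _ hn)

/-! ### Elementary loops that erase, move and copy stacks. -/

/-- A program with a single label. -/
def loop (σ : Type) [Fintype σ] (init : σ) (q : Stmt Γ Unit σ) : Fragment Γ :=
  ⟨Unit, (), σ, init, fun _ => q⟩

/-- Push the symbol `x` on the stack `k`. -/
def pushOne (k : K) (x : Γ k) : Fragment Γ :=
  loop Unit () (.push k (fun _ => x) .halt)

theorem runs_pushOne [DecidableEq K] (k : K) (x : Γ k) (S : ∀ k, List (Γ k)) :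
    (pushOne k x).Runs S (Function.update S k (x :: S k)) 1 :=
  ⟨1, le_rfl, _, rfl, rfl⟩

/-- The empty program. -/
def skip : Fragment Γ :=
  loop Unit () .halt

theorem runs_skip [DecidableEq K] (S : ∀ k, List (Γ k)) : (skip : Fragment Γ).Runs S S 1 :=
  ⟨1, le_rfl, _, rfl, rfl⟩

/-- Erase the stack `a`. -/
def clear (a : K) : Fragment Γ :=
  loop Bool false (.pop a (fun _ o => o.isSome) (.branch id (.goto fun _ => ()) .halt))

theorem runs_clear [DecidableEq K] (a : K) (S : ∀ k, List (Γ k)) :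
    (clear a).Runs S (Function.update S a []) ((S a).length + 1) := by
  refine ⟨_, le_rfl, ?_⟩
  have key : ∀ (l : List (Γ a)) (S : ∀ k, List (Γ k)) (b : Bool), S a = l →
      RunsIn (step (clear a : Fragment Γ).m) (l.length + 1) ⟨some (), b, S⟩
        ⟨none, false, Function.update S a []⟩ := by
    intro l
    induction l with
    | nil =>
      intro S b h
      exact ⟨_, rfl, by simp [RunsIn, clear, loop, h]⟩
    | cons x l ih =>
      intro S b h
      refine ⟨⟨some (), true, Function.update S a l⟩, by simp [clear, loop, h], ?_⟩
      have := ih (Function.update S a l) true (by simp)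
      rwa [Function.update_idem] at this
  exact key _ S _ rfl

/-- Move symbols from the stack `a` to the stack `b`, translated by `g`, as long as they
satisfy `p`; the first symbol that does not is erased. -/
def pour (a b : K) [Fintype (Γ a)] (p : Γ a → Bool) (g : Option (Γ a) → Γ b) : Fragment Γ :=
  loop (Option (Γ a)) none (.pop a (fun _ o => o)
    (.branch (fun o => o.any p) (.push b g (.goto fun _ => ())) (.load (fun _ => none) .halt)))

/-- `r` is empty or starts with a rejected symbol, which the last pop removes; `r.tail` covers both
cases. -/
theorem runs_pour [DecidableEq K] (a b : K) (hab : a ≠ b) [Fintype (Γ a)] (p : Γ a → Bool)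
    (g : Option (Γ a) → Γ b) (S : ∀ k, List (Γ k)) (l r : List (Γ a)) (hl : ∀ x ∈ l, p x = true)
    (hr : r.head?.any p = false) (hS : S a = l ++ r) :
    (pour a b p g).Runs S (Function.update (Function.update S a r.tail) b
      ((l.map fun x => g (some x)).reverse ++ S b)) (l.length + 1) := by
  refine ⟨_, le_rfl, ?_⟩
  have key : ∀ (l : List (Γ a)) (S : ∀ k, List (Γ k)) (o : Option (Γ a)), S a = l ++ r →
      (∀ x ∈ l, p x = true) →
      RunsIn (step (pour a b p g : Fragment Γ).m) (l.length + 1) ⟨some (), o, S⟩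
        ⟨none, none, Function.update (Function.update S a r.tail) b
          ((l.map fun x => g (some x)).reverse ++ S b)⟩ := by
    intro l
    induction l with
    | nil =>
      intro S o h _
      refine ⟨_, rfl, ?_⟩
      rw [List.nil_append] at h
      simp only [pour, loop, stepAux, h, hr, cond_false]
      have : Function.update S a r.tail b = S b := Function.update_of_ne hab.symm _ _
      simp [RunsIn, ← this]
    | cons x l ih =>
      intro S o h hl
      have hx : p x = true := hl x (by simp)
      refine ⟨⟨some (), some x, Function.update (Function.update S a (l ++ r)) b
        (g (some x) :: S b)⟩, by simp [pour, loop, h, hx, Function.update_of_ne hab.symm], ?_⟩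
      have := ih (Function.update (Function.update S a (l ++ r)) b (g (some x) :: S b)) (some x)
        (by rw [Function.update_of_ne hab]; simp) (fun y hy => hl y (by simp [hy]))
      rw [Function.update_comm hab.symm, Function.update_idem, Function.update_idem] at this
      simpa using this
  exact key _ S _ hS hl

/-- Move all symbols from the stack `a` to the stack `b`, translated by `g`. -/
def move (a b : K) [Fintype (Γ a)] (g : Option (Γ a) → Γ b) : Fragment Γ :=
  pour a b (fun _ => true) g

theorem runs_move [DecidableEq K] (a b : K) (hab : a ≠ b) [Fintype (Γ a)]
    (g : Option (Γ a) → Γ b) (S : ∀ k, List (Γ k)) :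
    (move a b g).Runs S (Function.update (Function.update S a []) b
      (((S a).map fun x => g (some x)).reverse ++ S b)) ((S a).length + 1) :=
  runs_pour a b hab _ g S (S a) [] (fun _ _ => rfl) rfl (by simp)

/-- Move all symbols from the stack `a` to both the stacks `b` and `c`. -/
def fork (a b c : K) [Fintype (Γ a)] (g : Option (Γ a) → Γ b) (g' : Option (Γ a) → Γ c) :
    Fragment Γ :=
  loop (Option (Γ a)) none (.pop a (fun _ o => o)
    (.branch Option.isSome (.push b g (.push c g' (.goto fun _ => ()))) .halt))

theorem runs_fork [DecidableEq K] (a b c : K) (hab : a ≠ b) (hac : a ≠ c) (hbc : b ≠ c)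
    [Fintype (Γ a)] (g : Option (Γ a) → Γ b) (g' : Option (Γ a) → Γ c) (S : ∀ k, List (Γ k)) :
    (fork a b c g g').Runs S (Function.update (Function.update (Function.update S a []) b
      (((S a).map fun x => g (some x)).reverse ++ S b)) c
      (((S a).map fun x => g' (some x)).reverse ++ S c)) ((S a).length + 1) := by
  refine ⟨_, le_rfl, ?_⟩
  have key : ∀ (l : List (Γ a)) (S : ∀ k, List (Γ k)) (o : Option (Γ a)), S a = l →
      RunsIn (step (fork a b c g g' : Fragment Γ).m) (l.length + 1) ⟨some (), o, S⟩
        ⟨none, none, Function.update (Function.update (Function.update S a []) b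
          ((l.map fun x => g (some x)).reverse ++ S b)) c
          ((l.map fun x => g' (some x)).reverse ++ S c)⟩ := by
    intro l
    induction l with
    | nil =>
      intro S o h
      refine ⟨_, rfl, ?_⟩
      have hb : Function.update S a [] b = S b := Function.update_of_ne hab.symm _ _
      have hc : Function.update S a [] c = S c := Function.update_of_ne hac.symm _ _
      simp [RunsIn, fork, loop, h, ← hb, ← hc]
    | cons x l ih =>
      intro S o h
      refine ⟨⟨some (), some x, Function.update (Function.update (Function.update S a l) b
        (g (some x) :: S b)) c (g' (some x) :: S c)⟩, by simp [fork, loop, h,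
          Function.update_of_ne hab.symm, Function.update_of_ne hac.symm,
          Function.update_of_ne hbc.symm], ?_⟩
      have := ih (Function.update (Function.update (Function.update S a l) b
        (g (some x) :: S b)) c (g' (some x) :: S c)) (some x)
        (by rw [Function.update_of_ne hac, Function.update_of_ne hab]; simp)
      refine Eq.mp ?_ this
      congr 2
      funext k
      by_cases h₁ : k = c
      · subst h₁; simp
      by_cases h₂ : k = b
      · subst h₂; simp [h₁]
      by_cases h₃ : k = a
      · subst h₃; simp [h₁, h₂]
      simp [h₁, h₂, h₃]
  exact key _ S _ rfl

end Fragment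

end AvgHard

/-! ### Polynomial-time functions as programs, and their composition. -/

namespace AvgHard

open Turing Turing.TM2

/-- The stack `k` contains `l`, and all other stacks are empty. -/
def single {K : Type} [DecidableEq K] {Γ : K → Type} (k : K) (l : List (Γ k)) :
    ∀ j, List (Γ j) :=
  Function.update (fun _ => []) k l

@[simp] theorem single_self {K : Type} [DecidableEq K] {Γ : K → Type} (k : K) (l : List (Γ k)) :
    single k l k = l :=
  Function.update_self ..

@[simp] theorem update_single {K : Type} [DecidableEq K] {Γ : K → Type} (k : K)
    (l l' : List (Γ k)) : Function.update (single k l) k l' = single k l' :=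
  Function.update_idem ..

@[simp] theorem single_nil {K : Type} [DecidableEq K] {Γ : K → Type} (k : K) :
    single (Γ := Γ) k [] = fun _ => [] :=
  Function.update_eq_self k (fun _ : K => [])

theorem length_single_le {K : Type} [DecidableEq K] {Γ : K → Type} (k j : K) (l : List (Γ k)) :
    (single k l j).length ≤ l.length := by
  by_cases h : j = k
  · subst h; simp
  · simp [single, Function.update_of_ne h]

/-- A program that computes the function `f` in polynomial time. -/
structure Program {k : ℕ} (f : (Fin k → List Bool) → List Bool) where
  K : Type
  [decK : DecidableEq K]
  [finK : Fintype K]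
  Γ : K → Type
  k₀ : K
  k₁ : K
  inp : Γ k₀ ≃ Option Bool
  out : Γ k₁ ≃ Bool
  frag : Fragment Γ
  time : Polynomial ℕ
  runs : ∀ v, frag.Runs (single k₀ ((encodeTuple v).map inp.symm))
    (single k₁ ((f v).map out.symm)) (time.eval (encodeTuple v).length)

attribute [instance] Program.decK Program.finK

instance {k : ℕ} {f : (Fin k → List Bool) → List Bool} (p : Program f) : Fintype (p.Γ p.k₀) :=
  Fintype.ofEquiv _ p.inp.symm

instance {k : ℕ} {f : (Fin k → List Bool) → List Bool} (p : Program f) : Fintype (p.Γ p.k₁) :=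
  Fintype.ofEquiv _ p.out.symm

theorem initList_eq (tm : FinTM2) (s : List (tm.Γ tm.k₀)) :
    initList tm s = ⟨some tm.main, tm.initialState, single tm.k₀ s⟩ := by
  unfold initList
  congr 1
  funext k
  by_cases h : k = tm.k₀
  · subst h; simp
  · simp [h, single]

theorem haltList_eq (tm : FinTM2) (s : List (tm.Γ tm.k₁)) :
    haltList tm s = ⟨none, tm.initialState, single tm.k₁ s⟩ := by
  unfold haltList
  congr 1
  funext k
  by_cases h : k = tm.k₁
  · subst h; simp
  · simp [h, single]

theorem Program.polyTime {k : ℕ} {f : (Fin k → List Bool) → List Bool} (p : Program f) :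
    PolyTime f := by
  refine ⟨⟨⟨⟨p.k₀, p.k₁, p.Γ, p.frag.Λ, p.frag.main, p.frag.σ, p.frag.init, p.frag.m⟩,
    p.inp, p.out⟩, p.time, fun v => ?_⟩⟩
  choose n hn h using p.runs
  refine ⟨⟨n v, ?_⟩, hn v⟩
  have := runsIn_iff_iterate.1 (h v)
  rw [initList_eq]
  simp only [Option.map_some, haltList_eq]
  exact this

theorem PolyTime.nonempty_program {k : ℕ} {f : (Fin k → List Bool) → List Bool}
    (h : PolyTime f) : Nonempty (Program f) := by
  obtain ⟨⟨⟨tm, ia, oa⟩, T, h⟩⟩ := h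
  have := tm.kFin
  refine ⟨⟨tm.K, tm.Γ, tm.k₀, tm.k₁, ia, oa, @Fragment.mk _ _ tm.Λ tm.ΛFin tm.main tm.σ tm.σFin
    tm.initialState tm.m, T, fun v => ?_⟩⟩
  obtain ⟨⟨n, e⟩, hn⟩ := h v
  refine ⟨n, hn, runsIn_iff_iterate.2 ?_⟩
  rw [initList_eq] at e
  simp only [Option.map_some, haltList_eq] at e
  exact e

theorem eval_mono_nat (p : Polynomial ℕ) : Monotone fun n : ℕ => p.eval n := by
  intro a b h
  simp only [Polynomial.eval_eq_sum_range]
  gcongr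

theorem Program.length_le {k : ℕ} {f : (Fin k → List Bool) → List Bool} (p : Program f) :
    ∃ q : Polynomial ℕ, ∀ v, (f v).length ≤ q.eval (encodeTuple v).length := by
  refine ⟨Polynomial.X + ((∑ l, Fragment.pushes (p.frag.m l) : ℕ) : Polynomial ℕ) * p.time, fun v => ?_⟩
  have h₁ := (p.runs v).length_le p.k₁
  have h₂ := length_single_le p.k₀ p.k₁ ((encodeTuple v).map p.inp.symm)
  simp only [single_self, List.length_map] at h₁ h₂
  simp only [Polynomial.eval_add, Polynomial.eval_X, Polynomial.eval_mul, Polynomial.eval_natCast]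
  exact h₁.trans (Nat.add_le_add_right h₂ _)

namespace Comp

open Fragment

variable {k k' : ℕ} {f : (Fin k' → List Bool) → List Bool}
  {g : Fin k' → (Fin k → List Bool) → List Bool} (p : Program f) (P : ∀ i, Program (g i))

/-- The stacks of the program for the composition: those of the inner programs, those of the outer
program, and two auxiliary stacks. -/
abbrev Stack : Type := (Σ i, (P i).K) ⊕ (p.K ⊕ Bool)

abbrev Alphabet : Stack p P → Type
  | .inl x => (P x.1).Γ x.2
  | .inr (.inl x) => p.Γ x
  | .inr (.inr _) => Option Bool

/-- The contents of the stacks. -/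
def state (x : ∀ i, ∀ j, List ((P i).Γ j)) (z : ∀ j, List (p.Γ j)) (u v : List (Option Bool)) :
    ∀ j, List (Alphabet p P j)
  | .inl y => x y.1 y.2
  | .inr (.inl y) => z y
  | .inr (.inr false) => u
  | .inr (.inr true) => v

variable {p P}

section

variable (x : ∀ i, ∀ j, List ((P i).Γ j)) (z : ∀ j, List (p.Γ j)) (u v : List (Option Bool))

theorem update_state_false (l : List (Option Bool)) :
    Function.update (state p P x z u v) (.inr (.inr false)) l = state p P x z l v := by
  funext j
  rcases j with y | y | (_ | _) <;> simp [Function.update, state]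

theorem update_state_true (l : List (Option Bool)) :
    Function.update (state p P x z u v) (.inr (.inr true)) l = state p P x z u l := by
  funext j
  rcases j with y | y | (_ | _) <;> simp [Function.update, state]

theorem update_state_outer (j : p.K) (l : List (p.Γ j)) :
    Function.update (state p P x z u v) (.inr (.inl j)) l =
      state p P x (Function.update z j l) u v := by
  funext j'
  rcases j' with y | y | (_ | _) <;> try simp [Function.update, state]
  by_cases h : y = j
  · subst h; simp
  · simp [h]

theorem update_state_inner (i : Fin k') (j : (P i).K) (l : List ((P i).Γ j)) :
    Function.update (state p P x z u v) (.inl ⟨i, j⟩) l =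
      state p P (Function.update x i (Function.update (x i) j l)) z u v := by
  funext j'
  rcases j' with ⟨i', y⟩ | y | (_ | _)
  · by_cases hi : i' = i
    · subst hi
      by_cases h : y = j
      · subst h; simp [state]
      · have : (Sum.inl ⟨i', y⟩ : Stack p P) ≠ Sum.inl ⟨i', j⟩ := by simpa using h
        simp [Function.update_of_ne this, state, Function.update_of_ne h]
    · have : (Sum.inl ⟨i', y⟩ : Stack p P) ≠ Sum.inl ⟨i, j⟩ := by simp [hi]
      simp [Function.update_of_ne this, state, Function.update_of_ne hi]
  all_goals simp [Function.update, state]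

end

variable (p P)

instance (b : Bool) : Fintype (Alphabet p P (.inr (.inr b))) :=
  inferInstanceAs (Fintype (Option Bool))

instance (i : Fin k') : Fintype (Alphabet p P (.inl ⟨i, (P i).k₁⟩)) :=
  inferInstanceAs (Fintype ((P i).Γ (P i).k₁))

/-- Compute `g i` and push the result, followed by an end marker, on the input stack of the outer
program. -/
def stage (i : Fin k') : Fragment (Alphabet p P) :=
  -- A move reverses the stack. The fork reverses it again, which restores the input for later
  -- stages and copies it for this one.
  (move (.inr (.inr false)) (.inr (.inr true)) (fun o : Option (Option Bool) => o.join)).seq <|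
  (fork (.inr (.inr true)) (.inr (.inr false)) (.inl ⟨i, (P i).k₀⟩)
    (fun o : Option (Option Bool) => o.join)
    (fun o : Option (Option Bool) => (P i).inp.symm o.join)).seq <|
  ((P i).frag.lift (Γ' := Alphabet p P) (fun j => .inl ⟨i, j⟩) fun _ => Equiv.refl _).seq <|
  -- The end marker lies below the result on the stack, so it is pushed before it.
  (pushOne (.inr (.inl p.k₀)) (p.inp.symm none)).seq <|
  (move (.inl ⟨i, (P i).k₁⟩) (.inr (.inr true))
    (fun o : Option ((P i).Γ (P i).k₁) => (o.map (P i).out : Option Bool))).seq <|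
  move (.inr (.inr true)) (.inr (.inl p.k₀))
    (fun o : Option (Option Bool) => p.inp.symm o.join)

theorem runs_stage (i : Fin k') : ∃ Q : Polynomial ℕ, ∀ v w,
    (stage p P i).Runs (state p P (fun _ _ => []) (single p.k₀ w) (encodeTuple v) [])
      (state p P (fun _ _ => [])
        (single p.k₀ (((g i v).map some ++ [none]).map p.inp.symm ++ w)) (encodeTuple v) [])
      (Q.eval (encodeTuple v).length) := by
  obtain ⟨q, hq⟩ := (P i).length_le
  refine ⟨(Polynomial.X + 1) + ((Polynomial.X + 1) + ((P i).time + (1 + ((q + 1) + (q + 1))))),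
    fun v w => ?_⟩
  have h₁ := runs_move (Γ := Alphabet p P) (.inr (.inr false)) (.inr (.inr true)) (by simp)
    (fun o : Option (Option Bool) => o.join)
    (state p P (fun _ _ => []) (single p.k₀ w) (encodeTuple v) [])
  rw [update_state_false, update_state_true] at h₁
  have h₂ := runs_fork (Γ := Alphabet p P) (.inr (.inr true)) (.inr (.inr false))
    (.inl ⟨i, (P i).k₀⟩) (by simp) (by simp) (by simp)
    (fun o : Option (Option Bool) => o.join)
    (fun o : Option (Option Bool) => (P i).inp.symm o.join)
    (state p P (fun _ _ => []) (single p.k₀ w) [] (encodeTuple v).reverse)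
  rw [update_state_true, update_state_false, update_state_inner] at h₂
  have h₃ := ((P i).runs v).lift (Γ' := Alphabet p P) (e := fun j => .inl ⟨i, j⟩)
    (fun a b h => by simpa using h) (fun _ => Equiv.refl _)
    (S' := state p P (Function.update (fun _ _ => []) i
      (single (P i).k₀ ((encodeTuple v).map (P i).inp.symm))) (single p.k₀ w) (encodeTuple v) [])
    (T' := state p P (Function.update (fun _ _ => []) i
      (single (P i).k₁ ((g i v).map (P i).out.symm))) (single p.k₀ w) (encodeTuple v) [])
    (by simp [state]) (by simp [state]) (by
      rintro (⟨i', y⟩ | y | (_ | _)) hj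
      · have : i' ≠ i := by
          rintro rfl
          exact hj y rfl
        simp [state, Function.update_of_ne this]
      all_goals rfl)
  have h₄ := runs_pushOne (Γ := Alphabet p P) (.inr (.inl p.k₀)) (p.inp.symm none)
    (state p P (Function.update (fun _ _ => []) i
      (single (P i).k₁ ((g i v).map (P i).out.symm))) (single p.k₀ w) (encodeTuple v) [])
  rw [update_state_outer, update_single] at h₄
  have h₅ := runs_move (Γ := Alphabet p P) (.inl ⟨i, (P i).k₁⟩) (.inr (.inr true)) (by simp)
    (fun o : Option ((P i).Γ (P i).k₁) => (o.map (P i).out : Option Bool))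
    (state p P (Function.update (fun _ _ => []) i
      (single (P i).k₁ ((g i v).map (P i).out.symm))) (single p.k₀ (p.inp.symm none :: w))
      (encodeTuple v) [])
  rw [update_state_inner, update_state_true] at h₅
  have h₆ := runs_move (Γ := Alphabet p P) (.inr (.inr true)) (.inr (.inl p.k₀)) (by simp)
    (fun o : Option (Option Bool) => p.inp.symm o.join)
    (state p P (fun _ _ => []) (single p.k₀ (p.inp.symm none :: w)) (encodeTuple v)
      ((g i v).map some).reverse)
  rw [update_state_true, update_state_outer, update_single] at h₆
  simp only [state, Option.join_some, List.map_id_fun', id, List.append_nil] at h₁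
  simp only [state, Option.join_some, List.map_id_fun', id, List.append_nil, List.map_reverse,
    List.reverse_reverse, List.length_reverse] at h₂
  simp only [state, single_self] at h₄
  simp only [state, Function.update_self, Function.update_idem, single_self, update_single,
    single_nil, List.map_map, List.length_map, List.append_nil, Option.map_some] at h₅
  simp only [state, single_self, Option.join_some, List.map_reverse, List.reverse_reverse,
    List.length_reverse, List.length_map] at h₆
  have e : (fun x => some ((P i).out x)) ∘ (P i).out.symm = some := by
    funext x; simp
  have e' : Function.update (fun (i : Fin k') (j : (P i).K) => ([] : List ((P i).Γ j))) i
      (fun _ => []) = fun _ _ => [] :=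
    Function.update_eq_self i (fun (i : Fin k') (j : (P i).K) => ([] : List ((P i).Γ j)))
  rw [e, e'] at h₅
  have e'' : List.map p.inp.symm (List.map some (g i v)) ++ p.inp.symm none :: w =
      ((g i v).map some ++ [none]).map p.inp.symm ++ w := by simp
  rw [e''] at h₆
  refine (h₁.seq <| h₂.seq <| h₃.seq <| h₄.seq <| h₅.seq h₆).mono ?_
  have := hq v
  simp only [Polynomial.eval_add, Polynomial.eval_X, Polynomial.eval_one]
  omega

/-- Compute `g i` for all `i` in a list. -/
def stages : List (Fin k') → Fragment (Alphabet p P)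
  | [] => skip
  -- Later components are pushed first, since the first one has to end up on top.
  | i :: l => (stages l).seq (stage p P i)

theorem runs_stages (l : List (Fin k')) : ∃ Q : Polynomial ℕ, ∀ v,
    (stages p P l).Runs (state p P (fun _ _ => []) (fun _ => []) (encodeTuple v) [])
      (state p P (fun _ _ => [])
        (single p.k₀ ((l.flatMap fun i => (g i v).map some ++ [none]).map p.inp.symm))
          (encodeTuple v) [])
      (Q.eval (encodeTuple v).length) := by
  induction l with
  | nil => exact ⟨1, fun v => by simpa [stages] using runs_skip _⟩
  | cons i l ih =>
    obtain ⟨Q, hQ⟩ := ih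
    obtain ⟨Q', hQ'⟩ := runs_stage p P i
    refine ⟨Q + Q', fun v => ?_⟩
    have := (hQ v).seq (hQ' v _)
    rw [← List.map_append] at this
    rw [Polynomial.eval_add]
    exact this

theorem encodeTuple_eq (v : Fin k → List Bool) :
    encodeTuple v = (List.finRange k).flatMap fun i => (v i).map some ++ [none] := by
  rw [encodeTuple, List.ofFn_eq_map, List.flatMap_map]

/-- The time of the outer program is polynomial in the length of its own input; this bounds that
length by the original input. -/
theorem exists_length_encodeTuple_le :
    (∀ i, Nonempty (Program (g i))) → ∃ Q : Polynomial ℕ, ∀ v,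
      (encodeTuple fun i => g i v).length ≤ Q.eval (encodeTuple v).length := by
  intro P
  simp only [encodeTuple_eq (k := k')]
  induction List.finRange k' with
  | nil => exact ⟨0, by simp⟩
  | cons i l ih =>
    obtain ⟨Q, hQ⟩ := ih
    obtain ⟨q, hq⟩ := (P i).some.length_le
    refine ⟨q + 1 + Q, fun v => ?_⟩
    have h₁ := hq v
    have h₂ := hQ v
    simp only [List.flatMap_cons, List.length_append, List.length_map, List.length_singleton,
      Polynomial.eval_add, Polynomial.eval_one]
    omega

/-- The program for the composition. -/
theorem nonempty_program (p : Program f) (P : ∀ i, Program (g i)) :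
    Nonempty (Program fun v => f fun i => g i v) := by
  obtain ⟨Q, hQ⟩ := runs_stages p P (List.finRange k')
  obtain ⟨R, hR⟩ := exists_length_encodeTuple_le (g := g) fun i => ⟨P i⟩
  refine ⟨⟨Stack p P, Alphabet p P, .inr (.inr false), .inr (.inl p.k₁), Equiv.refl _, p.out,
    (stages p P (List.finRange k')).seq
      -- The saved input is erased because a `Program` must halt with all stacks but the output
      -- empty.
      ((clear (.inr (.inr false))).seq (p.frag.lift (Γ' := Alphabet p P) (fun j => .inr (.inl j))
        fun _ => Equiv.refl _)), Q + ((Polynomial.X + 1) + p.time.comp R), fun v => ?_⟩⟩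
  have h₁ := hQ v
  rw [← encodeTuple_eq (fun i => g i v)] at h₁
  have h₂ := runs_clear (Γ := Alphabet p P) (.inr (.inr false)) (state p P (fun _ _ => [])
    (single p.k₀ ((encodeTuple fun i => g i v).map p.inp.symm)) (encodeTuple v) [])
  rw [update_state_false] at h₂
  have h₃ := (p.runs fun i => g i v).lift (Γ' := Alphabet p P) (e := fun j => .inr (.inl j))
    (fun a b h => by simpa using h) (fun _ => Equiv.refl _)
    (S' := state p P (fun _ _ => [])
      (single p.k₀ ((encodeTuple fun i => g i v).map p.inp.symm)) [] [])
    (T' := state p P (fun _ _ => [])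
      (single p.k₁ ((f fun i => g i v).map p.out.symm)) [] [])
    (by simp [state]) (by simp [state]) (by
      rintro (y | y | (_ | _)) hj
      · rfl
      · exact (hj y rfl).elim
      all_goals rfl)
  have h := (h₁.seq <| h₂.seq h₃).mono (t' := (Q + ((Polynomial.X + 1) + p.time.comp R)).eval
    (encodeTuple v).length) (by
      simp only [Polynomial.eval_add, Polynomial.eval_X, Polynomial.eval_one,
        Polynomial.eval_comp]
      have := eval_mono_nat p.time (hR v)
      simp only [state] at this ⊢
      omega)
  have e₀ : state p P (fun _ _ => []) (fun _ => []) [] [] = fun _ => [] := by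
    funext j
    rcases j with y | y | (_ | _) <;> rfl
  have e₁ : state p P (fun _ _ => []) (fun _ => []) (encodeTuple v) [] =
      single (.inr (.inr false)) (encodeTuple v) := by
    rw [single, ← e₀, update_state_false]
  have e₂ : state p P (fun _ _ => []) (single p.k₁ ((f fun i => g i v).map p.out.symm)) [] [] =
      single (.inr (.inl p.k₁)) ((f fun i => g i v).map p.out.symm) := by
    rw [single, single, ← update_state_outer, e₀]
  rw [e₁, e₂] at h
  simpa using h

end Comp

/-- Polynomial-time functions are closed under composition. -/
theorem PolyTime.comp {k k' : ℕ} {f : (Fin k' → List Bool) → List Bool}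
    {g : Fin k' → (Fin k → List Bool) → List Bool} (hf : PolyTime f) (hg : ∀ i, PolyTime (g i)) :
    PolyTime fun v => f fun i => g i v :=
  (Comp.nonempty_program hf.nonempty_program.some
    fun i => (hg i).nonempty_program.some).some.polyTime

end AvgHard

/-! ### Finite-state transducers and symbolwise combination of two strings. -/

namespace AvgHard

open Turing Turing.TM2

namespace Fragment

/-- Stacks over `Option Bool`, and an additional output stack over `Bool`. -/
abbrev WithOutput (K : Type) : Option K → Type
  | none => Bool
  | some _ => Option Bool

instance (K : Type) (j : K) : Fintype (WithOutput K (some j)) :=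
  inferInstanceAs (Fintype (Option Bool))

theorem single_some {K : Type} [DecidableEq K] (c j : K) (l : List (Option Bool)) :
    single (Γ := WithOutput K) (some c) l (some j) =
      single (Γ := fun _ : K => Option Bool) c l j := by
  by_cases hj : j = c
  · subst hj; rw [single_self, single_self]
  · have : (some j : Option K) ≠ some c := by simpa using hj
    rw [single, single, Function.update_of_ne hj, Function.update_of_ne this]

/-- A function is computed in polynomial time if some program on stacks over `Option Bool` computes
its reverse. -/
theorem polyTime_of_runs {K : Type} [DecidableEq K] [Fintype K] {k : ℕ}
    {f : (Fin k → List Bool) → List Bool} (P : Fragment fun _ : K => Option Bool) (a b : K)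
    (T : Polynomial ℕ)
    (h : ∀ v, P.Runs (single a (encodeTuple v)) (single b ((f v).reverse.map some))
      (T.eval (encodeTuple v).length)) : PolyTime f := by
  let F : Fragment (WithOutput K) :=
    (P.lift (Γ' := WithOutput K) some fun _ => Equiv.refl (Option Bool)).seq
      -- This move undoes the reversal. The default `false` is never used, as the stack holds only
      -- symbols `some _`.
      (move (Γ := WithOutput K) (some b) none fun o : Option (Option Bool) => o.join.getD false)
  have hF : ∀ v, F.Runs (single (Γ := WithOutput K) (some a) (encodeTuple v))
      (single (Γ := WithOutput K) none (f v))
      (T.eval (encodeTuple v).length + ((f v).length + 1)) := by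
    intro v
    have h₁ := (h v).lift (Γ' := WithOutput K) (e := some) (Option.some_injective _)
      (fun _ => Equiv.refl (Option Bool))
      (S' := single (Γ := WithOutput K) (some a) (encodeTuple v))
      (T' := single (Γ := WithOutput K) (some b) ((f v).reverse.map some))
      (fun j => by rw [single_some]; simp) (fun j => by rw [single_some]; simp) (by
        rintro (_ | j) hj
        · rfl
        · exact (hj j rfl).elim)
    have h₂ := runs_move (Γ := WithOutput K) (some b) none (by simp)
      (fun o : Option (Option Bool) => o.join.getD false)
      (single (Γ := WithOutput K) (some b) ((f v).reverse.map some))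
    rw [single_self, update_single, single_nil] at h₂
    have e : (((f v).reverse.map some).map
        fun x : Option Bool => (some x).join.getD false).reverse = f v := by
      simp [Function.comp_def]
    rw [e] at h₂
    have e' : single (Γ := WithOutput K) (some b) ((f v).reverse.map some) none = [] := rfl
    rw [e', List.append_nil, List.length_map, List.length_reverse] at h₂
    exact h₁.seq h₂
  refine Program.polyTime ⟨Option K, WithOutput K, some a, none, Equiv.refl _, Equiv.refl _, F,
    T + (Polynomial.X + ((∑ l, pushes (P.m l) : ℕ) : Polynomial ℕ) * T + 1), fun v => ?_⟩
  have h₁ := (h v).length_le b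
  have h₂ := length_single_le (Γ := fun _ : K => Option Bool) a b (encodeTuple v)
  rw [single_self, List.length_map, List.length_reverse] at h₁
  simp only [Equiv.refl_symm, Equiv.coe_refl, List.map_id]
  refine (hF v).mono ?_
  simp only [Polynomial.eval_add, Polynomial.eval_X, Polynomial.eval_mul,
    Polynomial.eval_natCast, Polynomial.eval_one, Nat.cast_id]
  omega

end Fragment

/-- The output of the finite-state transducer with the transitions `δ` and the outputs `e`, when
it reads a string in the state `q`. -/
def transduce {Q : Type} (δ : Q → Option Bool → Q) (e : Q → Option (Option Bool) → Option Bool) :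
    Q → List (Option Bool) → List Bool
  | q, [] => (e q none).toList
  | q, c :: l => (e q (some c)).toList ++ transduce δ e (δ q c) l

namespace Fragment

variable {K : Type}

/-- A finite-state transducer from the stack `a` to the stack `b`. -/
def transducer {Q : Type} [Fintype Q] (q₀ : Q) (δ : Q → Option Bool → Q)
    (e : Q → Option (Option Bool) → Option Bool) (a b : K) : Fragment fun _ : K => Option Bool :=
  loop (Q × Option (Option Bool)) (q₀, none) <|
    .pop a (fun s o => (s.1, o)) <|
    .branch (fun s => (e s.1 s.2).isSome)
      (.push b (fun s => e s.1 s.2) <|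
        .branch (fun s => s.2.isSome)
          (.load (fun s => (δ s.1 s.2.join, none)) (.goto fun _ => ()))
          (.load (fun _ => (q₀, none)) .halt))
      (.branch (fun s => s.2.isSome)
        (.load (fun s => (δ s.1 s.2.join, none)) (.goto fun _ => ()))
        (.load (fun _ => (q₀, none)) .halt))

theorem runs_transducer [DecidableEq K] {Q : Type} [Fintype Q] (q₀ : Q) (δ : Q → Option Bool → Q)
    (e : Q → Option (Option Bool) → Option Bool) (a b : K) (hab : a ≠ b)
    (l : List (Option Bool)) :
    (transducer q₀ δ e a b).Runs (single a l) (single b ((transduce δ e q₀ l).reverse.map some))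
      (l.length + 1) := by
  refine ⟨_, le_rfl, ?_⟩
  have key : ∀ (l r : List (Option Bool)) (q : Q),
      RunsIn (step (transducer q₀ δ e a b : Fragment fun _ : K => Option Bool).m) (l.length + 1)
        ⟨some (), (q, none), Function.update (single a l) b r⟩
        ⟨none, (q₀, none), single b ((transduce δ e q l).reverse.map some ++ r)⟩ := by
    intro l
    induction l with
    | nil =>
      intro r q
      have h₁ : (Function.update (fun _ => []) b r : K → List (Option Bool)) a = [] := by
        simp [Function.update_of_ne hab]
      have h₂ : (Function.update (Function.update (fun _ => []) b r) a [] :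
          K → List (Option Bool)) = Function.update (fun _ => []) b r := by
        funext j
        simp only [Function.update_apply]
        grind
      refine ⟨_, rfl, ?_⟩
      cases h : e q none <;> simp [RunsIn, transducer, loop, transduce, h, h₁, h₂, single]
    | cons c l ih =>
      intro r q
      have h₁ : (Function.update (single a (c :: l)) b r : K → List (Option Bool)) a = c :: l := by
        simp [Function.update_of_ne hab]
      have h₂ : (Function.update (Function.update (single a (c :: l)) b r) a l :
          K → List (Option Bool)) = Function.update (single a l) b r := by
        rw [Function.update_comm hab.symm, update_single]
      cases h : e q (some c) with
      | none =>
        have e' : transduce δ e q (c :: l) = transduce δ e (δ q c) l := by simp [transduce, h]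
        rw [e']
        exact ⟨⟨some (), (δ q c, none), Function.update (single a l) b r⟩,
          by simp [transducer, loop, h, h₁, h₂], ih r (δ q c)⟩
      | some x =>
        have e' : (transduce δ e q (c :: l)).reverse.map some ++ r =
            (transduce δ e (δ q c) l).reverse.map some ++ (some x :: r) := by
          simp [transduce, h]
        rw [e']
        refine ⟨⟨some (), (δ q c, none), Function.update (single a l) b (some x :: r)⟩,
          ?_, ih (some x :: r) (δ q c)⟩
        simp [transducer, loop, h, h₁, h₂]
  have := key l [] q₀
  rw [List.append_nil] at this
  refine Eq.mp ?_ this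
  congr 2
  have : (single a l : K → List (Option Bool)) b = [] := by
    simp [single, Function.update_of_ne hab.symm]
  funext j
  simp only [Function.update_apply]
  grind

end Fragment

/-- Functions computed by a finite-state transducer are computable in polynomial time. -/
theorem polyTime_of_transduce {k : ℕ} {f : (Fin k → List Bool) → List Bool} {Q : Type} [Fintype Q]
    (q₀ : Q) (δ : Q → Option Bool → Q) (e : Q → Option (Option Bool) → Option Bool)
    (h : ∀ v, transduce δ e q₀ (encodeTuple v) = f v) : PolyTime f := by
  refine Fragment.polyTime_of_runs (K := Bool) (Fragment.transducer q₀ δ e false true) false true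
    (Polynomial.X + 1) fun v => ?_
  rw [← h]
  simpa using Fragment.runs_transducer q₀ δ e false true (by simp) (encodeTuple v)

/-- Apply `φ` to the two strings symbol by symbol; the shorter string is continued by `none`. -/
def zipBits (φ : Option Bool → Option Bool → Option Bool) : List Bool → List Bool → List Bool
  | [], [] => []
  | x :: l, [] => (φ (some x) none).toList ++ zipBits φ l []
  | [], y :: l => (φ none (some y)).toList ++ zipBits φ [] l
  | x :: l, y :: l' => (φ (some x) (some y)).toList ++ zipBits φ l l'

namespace Fragment

variable {K : Type}

/-- Apply `φ` to the stacks `a` and `b` symbol by symbol, and push the results on `c`. -/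
def zipper (φ : Option Bool → Option Bool → Option Bool) (a b c : K) :
    Fragment fun _ : K => Option Bool :=
  loop (Option Bool × Option Bool) (none, none) <|
    -- `join` identifies an empty stack with an end marker; this is harmless because the stacks are
    -- free of end markers.
    .pop a (fun s o => (o.join, s.2)) <|
    .pop b (fun s o => (s.1, o.join)) <|
    .branch (fun s => s.1.isSome || s.2.isSome)
      (.branch (fun s => (φ s.1 s.2).isSome)
        (.push c (fun s => φ s.1 s.2) (.goto fun _ => ()))
        (.goto fun _ => ()))
      (.load (fun _ => (none, none)) .halt)

end Fragment

/-- The stacks `a`, `b` and `c` contain `x`, `y` and `z`, and all other stacks are empty. -/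
def triple {K : Type} [DecidableEq K] (a b c : K) (x y z : List (Option Bool)) :
    K → List (Option Bool) := fun j =>
  if j = a then x else if j = b then y else if j = c then z else []

namespace Fragment

variable {K : Type}

theorem runs_zipper [DecidableEq K] (φ : Option Bool → Option Bool → Option Bool) (a b c : K)
    (hab : a ≠ b) (hac : a ≠ c) (hbc : b ≠ c) (x y : List Bool) :
    (zipper φ a b c).Runs (triple a b c (x.map some) (y.map some) [])
      (triple a b c [] [] ((zipBits φ x y).reverse.map some)) (x.length + y.length + 1) := by
  have hpop : ∀ x y z : List (Option Bool),
      Function.update (Function.update (triple a b c x y z) a x.tail) b y.tail =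
        triple a b c x.tail y.tail z := by
    intro x y z
    funext j
    simp only [triple, Function.update_apply]
    grind
  have hpush : ∀ x y z z' : List (Option Bool),
      Function.update (triple a b c x y z) c z' = triple a b c x y z' := by
    intro x y z z'
    funext j
    simp only [triple, Function.update_apply]
    grind
  have ha : ∀ x y z, triple a b c x y z a = x := by simp [triple]
  have hb : ∀ x y z, triple a b c x y z b = y := by simp [triple, hab.symm]
  have hc : ∀ x y z, triple a b c x y z c = z := by simp [triple, hac.symm, hbc.symm]
  have hb' : ∀ x y z w, Function.update (triple a b c x y z) a w b = y := by
    simp [Function.update_of_ne hab.symm, hb]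
  have hstep : ∀ (x y : List Bool) (z : List (Option Bool)) (s : Option Bool × Option Bool),
      ∃ s', step (zipper φ a b c).m ⟨some (), s, triple a b c (x.map some) (y.map some) z⟩ =
        some (if x = [] ∧ y = [] then ⟨none, (none, none), triple a b c [] [] z⟩ else
          ⟨some (), s', triple a b c (x.tail.map some) (y.tail.map some)
            ((φ x.head? y.head?).toList.map some ++ z)⟩) := by
    intro x y z s
    refine ⟨(x.head?, y.head?), ?_⟩
    have hp := hpop (x.map some) (y.map some) z
    rw [← List.map_tail, ← List.map_tail] at hp
    cases x <;> cases y <;>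
      simp only [List.map_cons, List.map_nil, List.tail_cons, List.tail_nil, List.head?_cons,
        List.head?_nil] at hp ⊢ <;>
      simp only [zipper, loop, step, stepAux, ha, hb', List.tail_cons, List.tail_nil,
        List.head?_cons, List.head?_nil, hp, Option.join_some, Option.join_none]
    · simp
    all_goals
      simp only [Option.isSome_some, Option.isSome_none, Bool.or_true, Bool.true_or, cond_true,
        reduceCtorEq, and_false, false_and, if_false]
      generalize φ _ _ = o
      cases o <;> simp [hpush, hc]
  -- Every round before the last shortens at least one of the two strings, so the induction is on
  -- the total length.
  have key : ∀ (n : ℕ) (x y : List Bool), x.length + y.length ≤ n → ∀ z s, ∃ m ≤ n + 1,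
      RunsIn (step (zipper φ a b c).m) m
        ⟨some (), s, triple a b c (x.map some) (y.map some) z⟩
        ⟨none, (none, none), triple a b c [] [] ((zipBits φ x y).reverse.map some ++ z)⟩ := by
    intro n
    induction n with
    | zero =>
      intro x y hn z s
      have hx : x = [] := List.length_eq_zero_iff.1 (by omega)
      have hy : y = [] := List.length_eq_zero_iff.1 (by omega)
      obtain ⟨s', hs⟩ := hstep x y z s
      subst hx hy
      exact ⟨1, le_rfl, _, hs, by simp [RunsIn, zipBits]⟩
    | succ n ih =>
      intro x y hn z s
      obtain ⟨s', hs⟩ := hstep x y z s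
      by_cases h : x = [] ∧ y = []
      · obtain ⟨rfl, rfl⟩ := h
        exact ⟨1, by omega, _, hs, by simp [RunsIn, zipBits]⟩
      · rw [if_neg h] at hs
        obtain ⟨m, hm, r⟩ := ih x.tail y.tail
          (by cases x <;> cases y <;> simp_all; omega)
          ((φ x.head? y.head?).toList.map some ++ z) s'
        have e : (zipBits φ x y).reverse.map some ++ z =
            (zipBits φ x.tail y.tail).reverse.map some ++
              ((φ x.head? y.head?).toList.map some ++ z) := by
          have hrev : ∀ o : Option Bool, o.toList.reverse = o.toList := by
            rintro (_ | _) <;> rfl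
          cases x <;> cases y <;> simp_all [zipBits]
        refine ⟨m + 1, by omega, _, hs, ?_⟩
        rw [e]
        exact r
  obtain ⟨m, hm, r⟩ := key _ x y le_rfl [] (none, none)
  rw [List.append_nil] at r
  exact ⟨m, hm, r⟩

end Fragment

theorem encodeTuple_two (v : Fin 2 → List Bool) :
    encodeTuple v = (v 0).map some ++ none :: ((v 1).map some ++ [none]) := by
  simp [encodeTuple]

/-- Combining two strings symbol by symbol takes polynomial time. -/
theorem polyTime_zipBits (φ : Option Bool → Option Bool → Option Bool) :
    PolyTime fun v : Fin 2 → List Bool => zipBits φ (v 0) (v 1) := by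
  refine Fragment.polyTime_of_runs (K := Fin 6)
    ((Fragment.pour 0 1 Option.isSome Option.join).seq <|
      (Fragment.pour 0 2 Option.isSome Option.join).seq <|
      (Fragment.move 1 3 Option.join).seq <| (Fragment.move 2 4 Option.join).seq <|
      Fragment.zipper φ 3 4 5) 0 5 (4 * Polynomial.X + 10) fun v => ?_
  have cast : ∀ {P : Fragment fun _ : Fin 6 => Option Bool} {S S' T T' : Fin 6 → List (Option Bool)}
      {t : ℕ}, P.Runs S T t → S = S' → T = T' → P.Runs S' T' t := by
    rintro P S S' T T' t h rfl rfl
    exact h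
  set x := (v 0).map some with hx
  set y := (v 1).map some with hy
  have hp : ∀ l : List Bool, ∀ o ∈ l.map some, o.isSome = true := by
    intro l o ho
    obtain ⟨b, -, rfl⟩ := List.mem_map.1 ho
    rfl
  have h₁ := cast (T' := ![y ++ [none], x.reverse, [], [], [], []])
    (Fragment.runs_pour (Γ := fun _ : Fin 6 => Option Bool) 0 1 (by decide) Option.isSome
      Option.join (single 0 (encodeTuple v)) x (none :: (y ++ [none])) (hp _) rfl
      (by rw [single_self, encodeTuple_two])) rfl
    (by funext j; fin_cases j <;> simp [single])
  have h₂ := cast (T' := ![[], x.reverse, y.reverse, [], [], []])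
    (Fragment.runs_pour (Γ := fun _ : Fin 6 => Option Bool) 0 2 (by decide) Option.isSome
      Option.join ![y ++ [none], x.reverse, [], [], [], []] y [none] (hp _) rfl rfl) rfl
    (by funext j; fin_cases j <;> simp)
  have h₃ := cast (T' := ![[], [], y.reverse, x, [], []])
    (Fragment.runs_move (Γ := fun _ : Fin 6 => Option Bool) 1 3 (by decide) Option.join
      ![[], x.reverse, y.reverse, [], [], []]) rfl
    (by funext j; fin_cases j <;> simp)
  have h₄ := cast (T' := ![[], [], [], x, y, []])
    (Fragment.runs_move (Γ := fun _ : Fin 6 => Option Bool) 2 4 (by decide) Option.join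
      ![[], [], y.reverse, x, [], []]) rfl
    (by funext j; fin_cases j <;> simp)
  have h₅ := cast (S' := ![[], [], [], x, y, []])
    (T' := single 5 ((zipBits φ (v 0) (v 1)).reverse.map some))
    (Fragment.runs_zipper (K := Fin 6) φ 3 4 5 (by decide) (by decide) (by decide) (v 0) (v 1))
    (by funext j; fin_cases j <;> simp [triple, hx, hy])
    (by funext j; fin_cases j <;> simp [triple, single])
  refine (h₁.seq <| h₂.seq <| h₃.seq <| h₄.seq h₅).mono ?_
  have e : (encodeTuple v).length = (v 0).length + (v 1).length + 2 := by
    rw [encodeTuple_two]; simp; omega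
  simp [e, x, y]
  omega

end AvgHard

/-! ### Polynomial-time string operations: projections, pairs, prefixes, shifts. -/

namespace AvgHard

open Turing Turing.TM2

theorem PolyTime.comp_one {k : ℕ} {f : (Fin 1 → List Bool) → List Bool} (hf : PolyTime f)
    {g : (Fin k → List Bool) → List Bool} (hg : PolyTime g) : PolyTime fun v => f ![g v] := by
  have := hf.comp (g := ![g]) (by simpa using hg)
  refine Eq.mp ?_ this
  congr 1
  funext v
  congr 1
  funext i
  fin_cases i
  rfl

theorem PolyTime.comp_two {k : ℕ} {f : (Fin 2 → List Bool) → List Bool} (hf : PolyTime f)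
    {g h : (Fin k → List Bool) → List Bool} (hg : PolyTime g) (hh : PolyTime h) :
    PolyTime fun v => f ![g v, h v] := by
  have := hf.comp (g := ![g, h]) (by simp [Fin.forall_fin_two, hg, hh])
  refine Eq.mp ?_ this
  congr 1
  funext v
  congr 1
  funext i
  fin_cases i <;> rfl

theorem PolyTime.comp_four {k : ℕ} {f : (Fin 4 → List Bool) → List Bool} (hf : PolyTime f)
    {g₀ g₁ g₂ g₃ : (Fin k → List Bool) → List Bool} (h₀ : PolyTime g₀) (h₁ : PolyTime g₁)
    (h₂ : PolyTime g₂) (h₃ : PolyTime g₃) :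
    PolyTime fun v => f ![g₀ v, g₁ v, g₂ v, g₃ v] := by
  have := hf.comp (g := ![g₀, g₁, g₂, g₃]) (by
    intro i; fin_cases i <;> assumption)
  refine Eq.mp ?_ this
  congr 1
  funext v
  congr 1
  funext i
  fin_cases i <;> rfl

/-- Projections take polynomial time. -/
theorem polyTime_proj {k : ℕ} (i : Fin k) : PolyTime fun v : Fin k → List Bool => v i := by
  -- The state counts down at end markers, from `i + 1`. It is `1` exactly inside component `i`, and
  -- truncated subtraction keeps it at `0` afterwards.
  let δ : Fin (i + 2) → Option Bool → Fin (i + 2) := fun q o =>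
    if o.isSome then q else ⟨q - 1, by omega⟩
  let e : Fin (i + 2) → Option (Option Bool) → Option Bool := fun q o =>
    if q.1 = 1 then o.join else none
  refine polyTime_of_transduce (⟨i + 1, by omega⟩ : Fin (i + 2)) δ e fun v => ?_
  have seg : ∀ (x : List Bool) (l : List (Option Bool)) (q : Fin (i + 2)),
      transduce δ e q (x.map some ++ none :: l) =
        (if q.1 = 1 then x else []) ++ transduce δ e ⟨q - 1, by omega⟩ l := by
    intro x l q
    induction x with
    | nil => simp [transduce, δ, e]
    | cons b x ih =>
      rw [List.map_cons, List.cons_append, transduce]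
      have : δ q (some b) = q := by simp [δ]
      rw [this, ih]
      by_cases h : q.1 = 1 <;> simp [e, h]
  have all : ∀ (xs : List (List Bool)) (q : Fin (i + 2)),
      transduce δ e q (xs.flatMap fun x => x.map some ++ [none]) =
        if q.1 = 0 then [] else (xs[q.1 - 1]?).getD [] := by
    intro xs
    induction xs with
    | nil => intro q; simp [transduce, e]
    | cons x xs ih =>
      intro q
      rw [List.flatMap_cons, List.append_assoc, List.singleton_append, seg, ih]
      obtain ⟨_ | _ | q, hq⟩ := q <;> simp
  rw [encodeTuple, all]
  simp

/-- Testing whether one of the arguments is `[true]` takes polynomial time. -/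
theorem polyTime_anyTrue (k : ℕ) : PolyTime fun v : Fin k → List Bool =>
    if ∃ i, v i = [true] then [true] else [] := by
  -- First entry: `none` at the start of a component, `some true` if it reads `[true]` so far, `some
  -- false` once it differs. Second entry: whether an earlier component was `[true]`.
  let δ : Option Bool × Bool → Option Bool → Option Bool × Bool := fun q o =>
    match o with
    | some b => (some (q.1.isNone && b), q.2)
    | none => (none, q.2 || q.1 == some true)
  let e : Option Bool × Bool → Option (Option Bool) → Option Bool := fun q o =>
    if o = none ∧ q.2 then some true else none
  refine polyTime_of_transduce (none, false) δ e fun v => ?_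
  have skip : ∀ (x : List Bool) (l : List (Option Bool)) (c : Bool),
      transduce δ e (some false, c) (x.map some ++ none :: l) = transduce δ e (none, c) l := by
    intro x l c
    induction x with
    | nil => simp [transduce, δ, e]
    | cons b x ih => simpa [transduce, δ, e] using ih
  have seg : ∀ (x : List Bool) (l : List (Option Bool)) (c : Bool),
      transduce δ e (none, c) (x.map some ++ none :: l) =
        transduce δ e (none, c || x == [true]) l := by
    intro x l c
    obtain _ | ⟨b, _ | ⟨b', x⟩⟩ := x
    · simp [transduce, δ, e]
    · cases b <;> simp [transduce, δ, e]
    · have := skip x l c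
      simpa [transduce, δ, e] using this
  have all : ∀ (xs : List (List Bool)) (c : Bool),
      transduce δ e (none, c) (xs.flatMap fun x => x.map some ++ [none]) =
        if c = true ∨ [true] ∈ xs then [true] else [] := by
    intro xs
    induction xs with
    | nil => intro c; cases c <;> simp [transduce, e]
    | cons x xs ih =>
      intro c
      rw [List.flatMap_cons, List.append_assoc, List.singleton_append, seg, ih]
      have : (c || x == [true]) = true ∨ [true] ∈ xs ↔ c = true ∨ [true] ∈ x :: xs := by
        rw [List.mem_cons, Bool.or_eq_true, beq_iff_eq, or_assoc, eq_comm (a := x)]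
      simp only [this]
  rw [encodeTuple, all]
  simp [List.mem_ofFn]

/-- The pair of two bit strings, as a bit string. -/
def pairBits (x y : List Bool) : List Bool :=
  (x.flatMap fun b => [true, b]) ++ false :: y

/-- The first component of a pair. -/
def fstBits : List Bool → List Bool
  | true :: b :: l => b :: fstBits l
  | _ => []

/-- The second component of a pair. -/
def sndBits : List Bool → List Bool
  | true :: _ :: l => sndBits l
  | false :: l => l
  | _ => []

@[simp] theorem fstBits_pairBits (x y : List Bool) : fstBits (pairBits x y) = x := by
  induction x with
  | nil => simp [pairBits, fstBits]
  | cons b x ih => simpa [pairBits, fstBits] using ih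

@[simp] theorem sndBits_pairBits (x y : List Bool) : sndBits (pairBits x y) = y := by
  induction x with
  | nil => simp [pairBits, sndBits]
  | cons b x ih => simpa [pairBits, sndBits] using ih

theorem length_pairBits (x y : List Bool) : (pairBits x y).length = 2 * x.length + 1 + y.length := by
  induction x with
  | nil => simp [pairBits]; omega
  | cons b x ih => simp [pairBits] at ih ⊢; omega

theorem encodeTuple_one (v : Fin 1 → List Bool) : encodeTuple v = (v 0).map some ++ [none] := by
  simp [encodeTuple]

/-- The state of the parser of pairs: `none` expects a marker, `some true` a symbol of the first
component, `some false` the second component. -/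
def pairState : Option Bool → Option Bool → Option Bool
  | none, some b => some b
  | some true, some _ => none
  | q, _ => q

theorem PolyTime.fstBits {k : ℕ} {g : (Fin k → List Bool) → List Bool} (hg : PolyTime g) :
    PolyTime fun v => fstBits (g v) := by
  refine PolyTime.comp_one (f := fun v => AvgHard.fstBits (v 0)) ?_ hg
  let e : Option Bool → Option (Option Bool) → Option Bool := fun q o =>
    if q = some true then o.join else none
  refine polyTime_of_transduce none pairState e fun v => ?_
  rw [encodeTuple_one]
  have done : ∀ x : List Bool, transduce pairState e (some false) (x.map some ++ [none]) = [] := by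
    intro x
    induction x with
    | nil => simp [transduce, e]
    | cons b x ih => simpa [transduce, pairState, e] using ih
  induction v 0 using AvgHard.fstBits.induct with
  | case1 b l ih => simpa [transduce, pairState, e, AvgHard.fstBits] using ih
  | case2 l h =>
    obtain _ | ⟨_ | _, _ | ⟨b, l⟩⟩ := l
    · simp [transduce, pairState, e, AvgHard.fstBits]
    · simp [transduce, pairState, e, AvgHard.fstBits]
    · have := done (b :: l)
      simpa [transduce, pairState, e, AvgHard.fstBits] using this
    · simp [transduce, pairState, e, AvgHard.fstBits]
    · exact (h b l rfl).elim

theorem PolyTime.sndBits {k : ℕ} {g : (Fin k → List Bool) → List Bool} (hg : PolyTime g) :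
    PolyTime fun v => sndBits (g v) := by
  refine PolyTime.comp_one (f := fun v => AvgHard.sndBits (v 0)) ?_ hg
  let e : Option Bool → Option (Option Bool) → Option Bool := fun q o =>
    if q = some false then o.join else none
  refine polyTime_of_transduce none pairState e fun v => ?_
  rw [encodeTuple_one]
  have done : ∀ x : List Bool, transduce pairState e (some false) (x.map some ++ [none]) = x := by
    intro x
    induction x with
    | nil => simp [transduce, e, pairState]
    | cons b x ih => simpa [transduce, pairState, e] using ih
  induction v 0 using AvgHard.sndBits.induct with
  | case1 b l ih => simpa [transduce, pairState, e, AvgHard.sndBits] using ih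
  | case2 l =>
    have := done l
    simpa [transduce, pairState, e, AvgHard.sndBits] using this
  | case3 l h h' =>
    obtain _ | ⟨_ | _, _ | ⟨b, l⟩⟩ := l
    · simp [transduce, pairState, e, AvgHard.sndBits]
    · exact (h' _ rfl).elim
    · exact (h' _ rfl).elim
    · simp [transduce, pairState, e, AvgHard.sndBits]
    · exact (h _ _ rfl).elim

theorem PolyTime.zipBits {k : ℕ} (φ : Option Bool → Option Bool → Option Bool)
    {g h : (Fin k → List Bool) → List Bool} (hg : PolyTime g) (hh : PolyTime h) :
    PolyTime fun v => zipBits φ (g v) (h v) :=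
  (polyTime_zipBits φ).comp_two hg hh

/-- Only the length of `u` matters: numbers are passed in unary, which makes cutting a string a
symbolwise operation. -/
theorem zipBits_take (u w : List Bool) :
    zipBits (fun a b => if a.isSome then b else none) u w = w.take u.length := by
  induction u generalizing w with
  | nil => induction w with
    | nil => simp [zipBits]
    | cons b w ih => simpa [zipBits] using ih
  | cons a u ih =>
    cases w with
    | nil => simpa [zipBits] using ih []
    | cons b w => simpa [zipBits] using ih w

theorem PolyTime.take {k : ℕ} {g h : (Fin k → List Bool) → List Bool} (hg : PolyTime g)
    (hh : PolyTime h) : PolyTime fun v => (h v).take (g v).length := by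
  simpa only [zipBits_take] using hg.zipBits (fun a b => if a.isSome then b else none) hh

theorem zipBits_drop (u w : List Bool) :
    zipBits (fun a b => if a.isSome then none else b) u w = w.drop u.length := by
  induction u generalizing w with
  | nil => induction w with
    | nil => simp [zipBits]
    | cons b w ih => simpa [zipBits] using ih
  | cons a u ih =>
    cases w with
    | nil => simpa [zipBits] using ih []
    | cons b w => simpa [zipBits] using ih w

theorem PolyTime.drop {k : ℕ} {g h : (Fin k → List Bool) → List Bool} (hg : PolyTime g)
    (hh : PolyTime h) : PolyTime fun v => (h v).drop (g v).length := by
  simpa only [zipBits_drop] using hg.zipBits (fun a b => if a.isSome then none else b) hh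

/-- The string `x` shifted by `s`: bitwise exclusive or, where `s` is continued by zeros. -/
def shift : List Bool → List Bool → List Bool
  | [], _ => []
  | x :: l, [] => x :: l
  | x :: l, y :: s => (x ^^ y) :: shift l s

theorem zipBits_shift (x s : List Bool) :
    zipBits (fun a b => a.map fun a => a ^^ b.getD false) x s = shift x s := by
  induction x generalizing s with
  | nil => induction s with
    | nil => simp [zipBits, shift]
    | cons b s ih => simpa [zipBits, shift] using ih
  | cons a x ih =>
    cases s with
    | nil =>
      have := ih []
      cases x <;> simp_all [zipBits, shift]
    | cons b s => simpa [zipBits, shift] using ih s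

theorem PolyTime.shift {k : ℕ} {g h : (Fin k → List Bool) → List Bool} (hg : PolyTime g)
    (hh : PolyTime h) : PolyTime fun v => shift (g v) (h v) := by
  simpa only [zipBits_shift] using
    hg.zipBits (fun a b => a.map fun a => a ^^ b.getD false) hh

@[simp] theorem length_shift (x s : List Bool) : (shift x s).length = x.length := by
  induction x generalizing s with
  | nil => cases s <;> rfl
  | cons a x ih => cases s <;> simp [shift, ih]

theorem shift_shift (x s : List Bool) : shift (shift x s) s = x := by
  induction x generalizing s with
  | nil => cases s <;> rfl
  | cons a x ih => cases s <;> simp [shift, ih]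

/-- The mask between `x` and the seed `(shift x s).take n` does not depend on the first `n` bits of
`x`, since they cancel. Hence there are few masks to count in `exists_fiber`. -/
theorem shift_take_shift (x s : List Bool) (n : ℕ) (hn : n ≤ x.length) :
    shift x ((shift x s).take n) = shift (List.replicate n false) s ++ x.drop n := by
  induction n generalizing x s with
  | zero => cases x <;> simp [shift]
  | succ n ih =>
    obtain _ | ⟨a, x⟩ := x
    · simp at hn
    · have hn' : n ≤ x.length := by simpa using hn
      cases s with
      | nil =>
        have h := ih x [] hn'
        have h' : ∀ l, shift l [] = l := by intro l; cases l <;> rfl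
        rw [h', h'] at h
        simp [shift, List.replicate_succ, h]
      | cons b s => simp [shift, List.replicate_succ, ih x s hn']

/-- What follows the first `ℓ` bits of the shift is irrelevant, so a shift can be read off a
concatenation by giving its starting position. -/
theorem take_shift_append {ℓ : ℕ} (x : List Bool) (z s : Fin ℓ → Bool) (t : List Bool)
    (hz : x.take ℓ = List.ofFn z) :
    (shift x (List.ofFn s ++ t)).take ℓ = List.ofFn fun i => z i ^^ s i := by
  induction ℓ generalizing x with
  | zero => simp
  | succ ℓ ih =>
    obtain _ | ⟨a, x⟩ := x
    · simp at hz
    · simp only [List.ofFn_succ, List.take_succ_cons, List.cons.injEq] at hz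
      have := ih x (fun i => z i.succ) (fun i => s i.succ) hz.2
      simp [List.ofFn_succ, shift, hz.1, this]

end AvgHard

/-! ### Counting: covering by shifts, pigeonhole over masks, guessing. -/

namespace AvgHard

open Finset

/-- The sum `C` of the coefficients is absorbed by `C ≤ n ^ C`, which is where `2 ≤ n` enters. -/
theorem exists_eval_le_pow (p : Polynomial ℕ) : ∃ c : ℕ, ∀ n : ℕ, 2 ≤ n → p.eval n ≤ n ^ c := by
  refine ⟨(∑ i ∈ range (p.natDegree + 1), p.coeff i) + p.natDegree, fun n hn => ?_⟩
  rw [Polynomial.eval_eq_sum_range, pow_add]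
  calc ∑ i ∈ range (p.natDegree + 1), p.coeff i * n ^ i
      ≤ ∑ i ∈ range (p.natDegree + 1), p.coeff i * n ^ p.natDegree := by
        refine sum_le_sum fun i hi => Nat.mul_le_mul_left _ (Nat.pow_le_pow_right (by omega) ?_)
        have := mem_range.1 hi
        omega
    _ = (∑ i ∈ range (p.natDegree + 1), p.coeff i) * n ^ p.natDegree := by rw [sum_mul]
    _ ≤ _ := Nat.mul_le_mul_right _ (Nat.lt_pow_self (by omega)).le

theorem prob_fst {Ω Ω' : Type} [Fintype Ω] [Fintype Ω'] [Nonempty Ω'] (F : Ω → Prop) :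
    prob (fun ω : Ω × Ω' => F ω.1) = prob F := by
  classical
  have h : (univ.filter fun ω : Ω × Ω' => F ω.1) = (univ.filter F) ×ˢ univ := by
    ext ω; simp
  have h0 : (Fintype.card Ω' : ℝ) ≠ 0 := by simp
  unfold prob
  rw [Fintype.card_prod]
  have hc : ((univ.filter fun ω : Ω × Ω' => F ω.1).card : ℝ) =
      (univ.filter F).card * Fintype.card Ω' := by
    rw [h, card_product]; push_cast; rfl
  push_cast
  rw [← mul_div_mul_right _ (Fintype.card Ω : ℝ) h0, ← hc]

/-- A set of density at least `1/4` covers the cube by few shifts. -/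
theorem exists_cover {ℓ : ℕ} (P : Finset (Fin ℓ → Bool)) (hP : 2 ^ ℓ ≤ 4 * #P) :
    ∃ l : List (Fin ℓ → Bool), l.length = 3 * (ℓ + 1) ∧
      ∀ z : Fin ℓ → Bool, ∃ s ∈ l, (fun i => z i ^^ s i) ∈ P := by
  classical
  -- Greedy choice: each new shift leaves at most three quarters of the uncovered points uncovered.
  have key : ∀ k : ℕ, ∃ l : List (Fin ℓ → Bool), l.length = k ∧
      4 ^ k * #{z : Fin ℓ → Bool | ∀ s ∈ l, (fun i => z i ^^ s i) ∉ P} ≤ 3 ^ k * 2 ^ ℓ := by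
    intro k
    induction k with
    | zero => exact ⟨[], rfl, by simp⟩
    | succ k ih =>
      obtain ⟨l, hl, hk⟩ := ih
      set U : Finset (Fin ℓ → Bool) := {z | ∀ s ∈ l, (fun i => z i ^^ s i) ∉ P} with hU
      -- Double counting: for fixed `z` the map `s ↦ z ⊕ s` is a bijection, so each `z` is covered
      -- by exactly `#P` shifts. Some `s` is at least average.
      have hsum : ∑ s : Fin ℓ → Bool, #{z ∈ U | (fun i => z i ^^ s i) ∈ P} = #U * #P := by
        have := sum_card_bipartiteAbove_eq_sum_card_bipartiteBelow (s := U)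
          (t := (univ : Finset (Fin ℓ → Bool)))
          (fun z s => (fun i => z i ^^ s i) ∈ P)
        simp only [bipartiteAbove, bipartiteBelow] at this
        rw [← this, ← smul_eq_mul, ← sum_const]
        refine sum_congr rfl fun z _ => ?_
        refine card_bij' (fun s _ => fun i => z i ^^ s i) (fun p _ => fun i => z i ^^ p i)
          (by simp) ?_ (by simp) (by simp)
        intro p hp
        simpa using hp
      obtain ⟨s, -, hs⟩ : ∃ s ∈ (univ : Finset (Fin ℓ → Bool)),
          #U * #P ≤ #{z ∈ U | (fun i => z i ^^ s i) ∈ P} * 2 ^ ℓ := by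
        by_contra! h
        have h₁ := sum_lt_sum_of_nonempty univ_nonempty h
        rw [← sum_mul, hsum] at h₁
        simp at h₁
        rw [mul_comm] at h₁
        exact lt_irrefl _ h₁
      refine ⟨s :: l, by simp [hl], ?_⟩
      have hU' : ({z : Fin ℓ → Bool | ∀ s' ∈ s :: l, (fun i => z i ^^ s' i) ∉ P} : Finset _) =
          {z ∈ U | (fun i => z i ^^ s i) ∉ P} := by
        ext z
        simp [hU, and_comm]
      rw [hU']
      have hsplit := card_filter_add_card_filter_not (s := U)
        (fun z => (fun i => z i ^^ s i) ∈ P)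
      have h4 : #U ≤ 4 * #{z ∈ U | (fun i => z i ^^ s i) ∈ P} := by
        have h2 : 0 < 2 ^ ℓ := by positivity
        refine Nat.le_of_mul_le_mul_right ?_ h2
        calc #U * 2 ^ ℓ ≤ #U * (4 * #P) := Nat.mul_le_mul_left _ hP
          _ = 4 * (#U * #P) := by ring
          _ ≤ 4 * (#{z ∈ U | (fun i => z i ^^ s i) ∈ P} * 2 ^ ℓ) := Nat.mul_le_mul_left _ hs
          _ = _ := by ring
      calc 4 ^ (k + 1) * #{z ∈ U | (fun i => z i ^^ s i) ∉ P}
          = 4 ^ k * (4 * #{z ∈ U | (fun i => z i ^^ s i) ∉ P}) := by ring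
        _ ≤ 4 ^ k * (3 * #U) := Nat.mul_le_mul_left _ (by omega)
        _ = 3 * (4 ^ k * #U) := by ring
        _ ≤ 3 * (3 ^ k * 2 ^ ℓ) := Nat.mul_le_mul_left _ hk
        _ = _ := by ring
  -- Since `(3/4)^3 = 27/64 < 1/2`, three shifts per dimension leave fewer than one point, hence
  -- none.
  obtain ⟨l, hl, hc⟩ := key (3 * (ℓ + 1))
  refine ⟨l, hl, ?_⟩
  by_contra! h
  obtain ⟨z, hz⟩ := h
  have h1 : 1 ≤ #{z : Fin ℓ → Bool | ∀ s ∈ l, (fun i => z i ^^ s i) ∉ P} :=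
    card_pos.2 ⟨z, by simpa using hz⟩
  have h2 := (Nat.mul_le_mul_left (4 ^ (3 * (ℓ + 1))) h1).trans hc
  rw [mul_one, pow_mul, pow_mul] at h2
  norm_num only at h2
  have h3 : (27 : ℕ) ^ (ℓ + 1) * 2 ^ ℓ < 64 ^ (ℓ + 1) := by
    calc (27 : ℕ) ^ (ℓ + 1) * 2 ^ ℓ = 27 * 54 ^ ℓ := by
          rw [pow_succ, show (54 : ℕ) = 27 * 2 from rfl, mul_pow]; ring
      _ < 64 * 64 ^ ℓ := by
          have : (54 : ℕ) ^ ℓ ≤ 64 ^ ℓ := Nat.pow_le_pow_left (by norm_num) ℓ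
          have : 0 < (64 : ℕ) ^ ℓ := by positivity
          omega
      _ = _ := by ring
  omega

theorem exists_ofFn {n : ℕ} (l : List Bool) (h : l.length = n) :
    ∃ g : Fin n → Bool, List.ofFn g = l := by
  subst h
  exact ⟨fun i => l[i], by simp⟩

/-- Shifts that cover the cube, written as one bit string. -/
theorem exists_shifts {ℓ : ℕ} (P : Finset (Fin ℓ → Bool)) (hP : 2 ^ ℓ ≤ 4 * #P) :
    ∃ S : List Bool, S.length = 3 * (ℓ + 1) * ℓ ∧ ∀ x : List Bool, ℓ ≤ x.length →
      ∃ i ≤ S.length, ∃ r ∈ P, (shift x (S.drop i)).take ℓ = List.ofFn r := by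
  obtain ⟨l, hl, h⟩ := exists_cover P hP
  refine ⟨l.flatMap List.ofFn, ?_, fun x hx => ?_⟩
  · rw [← hl]
    simp [List.length_flatMap]
  · obtain ⟨z, hz⟩ := exists_ofFn (n := ℓ) (x.take ℓ) (by simpa using hx)
    obtain ⟨s, hs, hr⟩ := h z
    obtain ⟨l₁, l₂, rfl⟩ := List.append_of_mem hs
    refine ⟨(l₁.flatMap List.ofFn).length, by simp, _, hr, ?_⟩
    rw [List.flatMap_append, List.drop_left, List.flatMap_cons]
    exact take_shift_append x z s _ hz.symm

/-- If the strings `x`, shifted by one of few shifts that depends on `W x`, satisfy `Q` for many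
`x` and `ρ`, then so do many `r` for some fixed shift of `r` to a string `x` and some fixed `ρ`. -/
theorem exists_fiber {m ℓ c : ℕ} (hℓ : ℓ ≤ m) (S : List Bool)
    (W : List Bool → List Bool → List Bool) (j : List Bool → ℕ)
    (Q : List Bool → List Bool → Prop) [∀ x y, Decidable (Q x y)]
    (E : Finset ((Fin m → Bool) × (Fin c → Bool)))
    (hE : ∀ ω ∈ E, Q ((shift (List.ofFn ω.1) (S.drop (j (W (List.ofFn ω.1) (List.ofFn ω.2))))).take
      ℓ) (W (List.ofFn ω.1) (List.ofFn ω.2))) :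
    ∃ u ρ : List Bool, u.length = m ∧ ρ.length = c ∧
      #E ≤ #{r : Fin ℓ → Bool | Q (List.ofFn r) (W (shift u (List.ofFn r)) ρ)} *
        ((S.length + 1) * (2 ^ (m - ℓ) * 2 ^ c)) := by
  classical
  let r : (Fin m → Bool) × (Fin c → Bool) → List Bool := fun ω =>
    (shift (List.ofFn ω.1) (S.drop (j (W (List.ofFn ω.1) (List.ofFn ω.2))))).take ℓ
  have hr : ∀ ω, (r ω).length = ℓ := fun ω => by simp [r, hℓ]
  -- The pair of mask and coins; `T` below contains all its values on `E`, and its most popular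
  -- value is fixed.
  let f : (Fin m → Bool) × (Fin c → Bool) → List Bool × (Fin c → Bool) := fun ω =>
    (shift (List.ofFn ω.1) (r ω), ω.2)
  have hf : ∀ ω, shift (f ω).1 (r ω) = List.ofFn ω.1 := fun ω => shift_shift _ _
  let t : Fin (S.length + 1) × (Fin (m - ℓ) → Bool) × (Fin c → Bool) →
      List Bool × (Fin c → Bool) := fun p =>
    (shift (List.replicate ℓ false) (S.drop p.1) ++ List.ofFn p.2.1, p.2.2)
  let T := univ.image t
  have hT : #T ≤ (S.length + 1) * (2 ^ (m - ℓ) * 2 ^ c) := by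
    refine card_image_le.trans ?_
    simp
  have hfT : ∀ ω ∈ E, f ω ∈ T := by
    intro ω _
    obtain ⟨y, hy⟩ := exists_ofFn (n := m - ℓ) ((List.ofFn ω.1).drop ℓ) (by simp)
    set i := j (W (List.ofFn ω.1) (List.ofFn ω.2)) with hi
    refine mem_image.2 ⟨(⟨min i S.length, by omega⟩, y, ω.2), mem_univ _, ?_⟩
    -- The position comes from an arbitrary algorithm and may exceed the length of `S`; then the
    -- shift is trivial. This leaves `S.length + 1` cases.
    have hd : S.drop (min i S.length) = S.drop i := by
      rcases le_total i S.length with h | h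
      · rw [min_eq_left h]
      · rw [min_eq_right h, List.drop_length, List.drop_eq_nil_of_le h]
    simp only [t, f, r, hd, hy]
    rw [shift_take_shift _ _ _ (by simpa using hℓ)]
  obtain ⟨b, hb, hmax⟩ := exists_max_image T (fun b => #{ω ∈ E | f ω = b})
    (univ_nonempty.image t)
  refine ⟨b.1, List.ofFn b.2, ?_, by simp, ?_⟩
  · obtain ⟨p, -, rfl⟩ := mem_image.1 hb
    simp [t]
    omega
  refine (card_le_mul_card_image_of_maps_to hfT _ hmax).trans (Nat.mul_le_mul ?_ hT)
  choose g hg using fun ω => exists_ofFn (r ω) (hr ω)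
  -- Within a fibre of `f` the seed determines the string, as mask applied to seed, so distinct
  -- points of the fibre give distinct seeds.
  refine card_le_card_of_injOn g ?_ ?_
  · intro ω hω
    obtain ⟨hω', rfl⟩ := mem_filter.1 hω
    simp only [coe_filter, mem_univ, true_and, Set.mem_ofPred_eq, hg, hf]
    exact hE ω hω'
  · intro ω hω ω' hω' h
    obtain ⟨_, h₁⟩ := mem_filter.1 hω
    obtain ⟨_, h₂⟩ := mem_filter.1 hω'
    have h₃ : r ω = r ω' := by rw [← hg, ← hg, h]
    have h₄ : List.ofFn ω.1 = List.ofFn ω'.1 := by rw [← hf, ← hf, h₁, h₂, h₃]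
    have h₅ : ω.2 = ω'.2 := (congrArg Prod.snd h₁).trans (congrArg Prod.snd h₂).symm
    exact Prod.ext (List.ofFn_injective h₄) h₅

/-- Accepting on a part `G` of `P` and giving the better constant answer elsewhere decides `P` with
advantage `#G / 2`. -/
theorem exists_constant_answer {Ω : Type} [Fintype Ω] (G P : Ω → Prop) [DecidablePred G]
    [DecidablePred P] (h : ∀ ω, G ω → P ω) :
    ∃ b : Bool, Fintype.card Ω + #{ω | G ω} ≤ 2 * #{ω | (b = true ∨ G ω) ↔ P ω} := by
  classical
  have h₁ : #{ω | P ω} + #{ω | ¬ P ω} = Fintype.card Ω := card_filter_add_card_filter_not _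
  have h₂ : #{ω | G ω} + #{ω | ¬ P ω} ≤ #{ω | G ω ↔ P ω} := by
    rw [← card_union_of_disjoint]
    · refine card_le_card fun ω => ?_
      have := h ω
      simp only [mem_union, mem_filter, mem_univ, true_and]
      tauto
    · rw [disjoint_filter]
      exact fun ω _ hG hP => hP (h ω hG)
  -- Saying "yes" everywhere is right on `P`, saying "yes" only on `G` is right on `G` and off `P`.
  -- The two counts add up to `#Ω + #G`, so the larger is at least half of that.
  by_cases hc : #{ω | P ω} ≥ #{ω | G ω} + #{ω | ¬ P ω}
  · refine ⟨true, ?_⟩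
    simp
    omega
  · refine ⟨false, ?_⟩
    simp
    omega

end AvgHard

/-! ### The verifier, the decider and its advantage. -/

namespace AvgHard

open Finset

/-- `[true]` if one of the strings is `[true]`, and the empty string otherwise. -/
def anyTrue {k : ℕ} (v : Fin k → List Bool) : List Bool :=
  if ∃ i, v i = [true] then [true] else []

theorem anyTrue_two (x y : List Bool) : anyTrue ![x, y] = [true] ↔ x = [true] ∨ y = [true] := by
  simp [anyTrue, Fin.exists_fin_two, or_iff_not_imp_left]

/-- The verifier for shifted seeds. The advice consists of a flag (accept everything), the parameter
and the seed length in unary, the maximal length of witnesses in unary, and the shifts. A solution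
consists of the position of a shift in unary, and a witness. -/
def shiftVerifier (V sample : (Fin 2 → List Bool) → List Bool) (v : Fin 3 → List Bool) :
    List Bool :=
  anyTrue ![fstBits (v 0), V ![sample ![fstBits (sndBits (v 0)),
      (shift (v 1) ((sndBits (sndBits (sndBits (sndBits (v 0))))).drop
        (fstBits (v 2)).length)).take (fstBits (sndBits (sndBits (v 0)))).length],
    (sndBits (v 2)).take (fstBits (sndBits (sndBits (sndBits (v 0))))).length]]

theorem polyTime_shiftVerifier {V sample : (Fin 2 → List Bool) → List Bool} (hV : PolyTime V)
    (hs : PolyTime sample) : PolyTime (shiftVerifier V sample) := by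
  have h₀ := polyTime_proj (0 : Fin 3)
  have h₁ := polyTime_proj (1 : Fin 3)
  have h₂ := polyTime_proj (2 : Fin 3)
  exact (polyTime_anyTrue 2).comp_two h₀.fstBits <| hV.comp_two
    (hs.comp_two h₀.sndBits.fstBits <| h₀.sndBits.sndBits.fstBits.take <|
      h₁.shift <| h₂.fstBits.drop h₀.sndBits.sndBits.sndBits.sndBits)
    (h₀.sndBits.sndBits.sndBits.fstBits.take h₂.sndBits)

/-- The decision algorithm that runs the search algorithm `A` on the shifted seed, and answers "yes"
if this produces a witness. The advice consists of the advice of `A`, the shift, the coins of `A`,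
the maximal length of witnesses in unary, and the answer if there is no witness. -/
def shiftDecider (V : (Fin 2 → List Bool) → List Bool) (A : (Fin 4 → List Bool) → List Bool)
    (v : Fin 4 → List Bool) : List Bool :=
  anyTrue ![sndBits (sndBits (sndBits (sndBits (v 0)))), V ![v 2,
    (sndBits (A ![fstBits (v 0), shift (fstBits (sndBits (v 0))) (v 1),
      shift (fstBits (sndBits (v 0))) (v 1), fstBits (sndBits (sndBits (v 0)))])).take
        (fstBits (sndBits (sndBits (sndBits (v 0))))).length]]

theorem polyTime_shiftDecider {V : (Fin 2 → List Bool) → List Bool}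
    {A : (Fin 4 → List Bool) → List Bool} (hV : PolyTime V) (hA : PolyTime A) :
    PolyTime (shiftDecider V A) := by
  have h₀ := polyTime_proj (0 : Fin 4)
  have h₁ := polyTime_proj (1 : Fin 4)
  have h₂ := polyTime_proj (2 : Fin 4)
  have hs := h₀.sndBits.fstBits.shift h₁
  exact (polyTime_anyTrue 2).comp_two h₀.sndBits.sndBits.sndBits.sndBits <| hV.comp_two h₂ <|
    h₀.sndBits.sndBits.sndBits.fstBits.take
      (hA.comp_four h₀.fstBits hs hs h₀.sndBits.sndBits.fstBits).sndBits

section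

variable {L : Language Bool} {V : (Fin 2 → List Bool) → List Bool} {q : Polynomial ℕ}

/-- For large `n`, at least a quarter of the seeds give elements of the language. -/
theorem HardLanguage.density {D : Sampler} (h : HardLanguage L D)
    [∀ n, DecidablePred fun r : Fin (D.seedLen.eval n) → Bool => D.draw n r ∈ L] :
    ∀ᶠ n in Filter.atTop, 2 ^ D.seedLen.eval n ≤
      4 * #{r : Fin (D.seedLen.eval n) → Bool | D.draw n r ∈ L} := by
  -- The algorithm returns its empty advice, so it always says "no". For `n ≥ 4` it is right with
  -- probability below `1/2 + 1/4`.
  have h₁ := h (fun v => v 0) (fun _ => []) 0 (polyTime_proj 0) ⟨0, by simp⟩ 1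
  filter_upwards [h₁, Filter.eventually_ge_atTop 4] with n h₁ hn
  have h₂ := prob_fst (Ω' := Fin ((0 : Polynomial ℕ).eval n) → Bool)
    (fun r : Fin (D.seedLen.eval n) → Bool => ¬ D.draw n r ∈ L)
  simp only [Matrix.cons_val_zero, List.nil_eq, reduceCtorEq, false_iff] at h₁
  rw [h₂] at h₁
  have h₃ : (1 : ℝ) / (n : ℝ) ^ 1 ≤ 1 / 4 := by
    rw [pow_one]
    exact one_div_le_one_div_of_le (by norm_num) (by exact_mod_cast hn)
  have h₄ := card_filter_add_card_filter_not (s := univ)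
    (fun r : Fin (D.seedLen.eval n) → Bool => D.draw n r ∈ L)
  have hcard : Fintype.card (Fin (D.seedLen.eval n) → Bool) = 2 ^ D.seedLen.eval n := by simp
  rw [card_univ, hcard] at h₄
  unfold prob at h₁
  rw [hcard, div_lt_iff₀ (by positivity)] at h₁
  have h₅ : (#{r : Fin (D.seedLen.eval n) → Bool | ¬ D.draw n r ∈ L} : ℝ) <
      (1 / 2 + 1 / (n : ℝ) ^ 1) * ((2 ^ D.seedLen.eval n : ℕ) : ℝ) := by
    refine lt_of_eq_of_lt ?_ h₁
    congr!
  have h₆ : (0 : ℝ) < ((2 ^ D.seedLen.eval n : ℕ) : ℝ) := by positivity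
  have h₇ : (#{r : Fin (D.seedLen.eval n) → Bool | ¬ D.draw n r ∈ L} : ℝ) * 4 <
      3 * ((2 ^ D.seedLen.eval n : ℕ) : ℝ) := by nlinarith
  have h₈ : #{r : Fin (D.seedLen.eval n) → Bool | ¬ D.draw n r ∈ L} * 4 <
      3 * 2 ^ D.seedLen.eval n := by exact_mod_cast h₇
  omega

/-- An algorithm that finds witnesses for many shifted seeds yields advice with which the language
is decided with a noticeable advantage. -/
theorem exists_advice_shiftDecider
    (hV : ∀ x, x ∈ L ↔ ∃ w : List Bool, w.length ≤ q.eval x.length ∧ V ![x, w] = [true])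
    (D : Sampler) {n m c : ℕ} (hm : D.seedLen.eval n ≤ m) (S a : List Bool)
    (A : (Fin 4 → List Bool) → List Bool) (E : Finset ((Fin m → Bool) × (Fin c → Bool)))
    (hE : ∀ ω ∈ E, V ![D.sample ![List.replicate n true, (shift (List.ofFn ω.1) (S.drop
        (fstBits (A ![a, List.ofFn ω.1, List.ofFn ω.1, List.ofFn ω.2])).length)).take
          (D.seedLen.eval n)],
      (sndBits (A ![a, List.ofFn ω.1, List.ofFn ω.1, List.ofFn ω.2])).take (q.eval n)] = [true]) :
    ∃ adv : List Bool, adv.length = 2 * a.length + 2 * m + 2 * c + 2 * q.eval n + 5 ∧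
      (1 / 2 + (#E : ℝ) / (2 ^ m * 2 ^ c) / (2 * (S.length + 1)) : ℝ) ≤
        prob fun ω : (Fin (D.seedLen.eval n) → Bool) ×
            (Fin ((0 : Polynomial ℕ).eval n) → Bool) =>
          (shiftDecider V A ![adv, List.ofFn ω.1, D.draw n ω.1, List.ofFn ω.2] = [true] ↔
            D.draw n ω.1 ∈ L) := by
  classical
  set ℓ := D.seedLen.eval n with hℓ
  obtain ⟨u, ρ, hu, hρ, hcard⟩ := exists_fiber hm S (fun x ρ => A ![a, x, x, ρ])
    (fun w => (fstBits w).length)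
    (fun r w => V ![D.sample ![List.replicate n true, r], (sndBits w).take (q.eval n)] = [true])
    E hE
  set G : (Fin ℓ → Bool) → Prop := fun r => V ![D.sample ![List.replicate n true, List.ofFn r],
    (sndBits (A ![a, shift u (List.ofFn r), shift u (List.ofFn r), ρ])).take (q.eval n)] = [true]
    with hG
  have hGL : ∀ r, G r → D.draw n r ∈ L := by
    intro r hr
    -- Truncation to length `q.eval n` makes every accepted string a legitimate witness.
    refine (hV _).2 ⟨_, ?_, hr⟩
    rw [Sampler.draw, D.length_sample _ _ (by simp)]
    simp
  obtain ⟨b, hb⟩ := exists_constant_answer G (fun r => D.draw n r ∈ L) hGL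
  refine ⟨pairBits a (pairBits u (pairBits ρ (pairBits (List.replicate (q.eval n) true) [b]))),
    ?_, ?_⟩
  · simp only [length_pairBits, List.length_replicate, List.length_singleton, hu, hρ]
    omega
  · have h₁ := prob_fst (Ω' := Fin ((0 : Polynomial ℕ).eval n) → Bool)
      (fun r : Fin ℓ → Bool => ((b = true ∨ G r) ↔ D.draw n r ∈ L))
    have h₂ : ∀ ω : (Fin ℓ → Bool) × (Fin ((0 : Polynomial ℕ).eval n) → Bool),
        shiftDecider V A ![pairBits a (pairBits u (pairBits ρ (pairBits (List.replicate (q.eval n)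
          true) [b]))), List.ofFn ω.1, D.draw n ω.1, List.ofFn ω.2] = [true] ↔
        (b = true ∨ G ω.1) := by
      intro ω
      simp [shiftDecider, anyTrue_two, hG, Sampler.draw]
    simp only [h₂]
    rw [h₁]
    unfold prob
    have hc : Fintype.card (Fin ℓ → Bool) = 2 ^ ℓ := by simp
    rw [hc] at hb ⊢
    have hb' : ((2 : ℝ) ^ ℓ + #{r | G r}) ≤ 2 * #{r | (b = true ∨ G r) ↔ D.draw n r ∈ L} := by
      exact_mod_cast hb
    have hE' : (#E : ℝ) ≤ #{r | G r} * ((S.length + 1) * (2 ^ (m - ℓ) * 2 ^ c)) := by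
      exact_mod_cast hcard
    have hpow : (2 : ℝ) ^ m = 2 ^ (m - ℓ) * 2 ^ ℓ := by
      rw [← pow_add, Nat.sub_add_cancel hm]
    -- The surplus bits and the coins cancel. The loss is `S.length + 1` from the positions and `2`
    -- from the guess.
    have h₃ : (#E : ℝ) / (2 ^ m * 2 ^ c) / (2 * (S.length + 1)) ≤ #{r | G r} / (2 * 2 ^ ℓ) := by
      rw [div_div, div_le_div_iff₀ (by positivity) (by positivity), hpow]
      calc (#E : ℝ) * (2 * 2 ^ ℓ)
          ≤ #{r | G r} * ((S.length + 1) * (2 ^ (m - ℓ) * 2 ^ c)) * (2 * 2 ^ ℓ) := by gcongr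
        _ = _ := by ring
    have h₄ : (1 / 2 + #{r | G r} / (2 * 2 ^ ℓ) : ℝ) ≤
        #{r | (b = true ∨ G r) ↔ D.draw n r ∈ L} / ((2 ^ ℓ : ℕ) : ℝ) := by
      push_cast
      rw [le_div_iff₀ (by positivity)]
      have : (1 / 2 + #{r | G r} / (2 * 2 ^ ℓ) : ℝ) * 2 ^ ℓ = ((2 : ℝ) ^ ℓ + #{r | G r}) / 2 := by
        field_simp
      rw [this]
      linarith
    refine (add_le_add_right h₃ _).trans (h₄.trans (le_of_eq ?_))
    congr!

end

/-- The distribution that is uniform on the strings of length `n`. -/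
noncomputable def uniformSampler : Sampler where
  seedLen := Polynomial.X
  sample v := v 1
  polyTime := polyTime_proj 1
  length_sample n r h := by simpa using h

end AvgHard

/-! ### Matching instance lengths with parameters. -/

namespace AvgHard

open Finset

/-- The largest parameter up to `m` for which the seeds have length at most `m`. -/
def seedParam (ℓ : Polynomial ℕ) (m : ℕ) : ℕ :=
  Nat.findGreatest (fun n => ℓ.eval n ≤ m) m

theorem seedParam_le (ℓ : Polynomial ℕ) (m : ℕ) : seedParam ℓ m ≤ m :=
  Nat.findGreatest_le _

theorem le_seedParam {ℓ : Polynomial ℕ} {m n : ℕ} (h : n ≤ m) (h' : ℓ.eval n ≤ m) :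
    n ≤ seedParam ℓ m :=
  Nat.le_findGreatest h h'

theorem eval_seedParam_le {ℓ : Polynomial ℕ} {m : ℕ} (h : ℓ.eval 0 ≤ m) :
    ℓ.eval (seedParam ℓ m) ≤ m :=
  Nat.findGreatest_spec (P := fun n => ℓ.eval n ≤ m) (Nat.zero_le m) h

/-- Either the parameter is `m` itself, or its successor fails, which means that its seeds are
longer than `m`. So quantities polynomial in `m` are polynomial in the parameter. -/
theorem le_eval_seedParam (ℓ : Polynomial ℕ) (m : ℕ) :
    m ≤ seedParam ℓ m + ℓ.eval (seedParam ℓ m + 1) := by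
  rcases (seedParam_le ℓ m).lt_or_eq with h | h
  · have := Nat.findGreatest_is_greatest (P := fun n => ℓ.eval n ≤ m) (n := m)
      (Nat.lt_succ_self (seedParam ℓ m)) h
    simp only [Nat.succ_eq_add_one, not_le] at this
    omega
  · omega

theorem tendsto_seedParam (ℓ : Polynomial ℕ) :
    Filter.Tendsto (seedParam ℓ) Filter.atTop Filter.atTop := by
  refine Filter.tendsto_atTop.2 fun n => ?_
  filter_upwards [Filter.eventually_ge_atTop (max n (ℓ.eval n))] with m hm
  exact le_seedParam (le_of_max_le_left hm) (le_of_max_le_right hm)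

end AvgHard

/-! ### The search problem and the reduction. -/

theorem theorem4p2
    (h : ∃ L : Language Bool, AvgHard.InNP L ∧ ∃ D : AvgHard.Sampler, AvgHard.HardLanguage L D) :
    ∃ R : List Bool → List Bool → Prop,
      AvgHard.InTFNPPoly R ∧ ∃ D : AvgHard.Sampler, AvgHard.HardSearch R D := by
  classical
  open AvgHard in
  obtain ⟨L, ⟨V, q, hVt, hV⟩, D, hD⟩ := h
  set ℓ := D.seedLen
  let N := seedParam ℓ
  -- Density holds only eventually, but totality is required for every length: at lengths that are
  -- not good, the flag in the advice makes the verifier accept everything.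
  let Good : ℕ → Prop := fun m => ℓ.eval (N m) ≤ m ∧ 2 ^ ℓ.eval (N m) ≤
    4 * (Finset.univ.filter fun r : Fin (ℓ.eval (N m)) → Bool => D.draw (N m) r ∈ L).card
  have hGood : ∀ᶠ m in Filter.atTop, Good m := by
    filter_upwards [Filter.eventually_ge_atTop (ℓ.eval 0),
      (tendsto_seedParam ℓ).eventually hD.density] with m h₁ h₂
    exact ⟨eval_seedParam_le h₁, h₂⟩
  have hS : ∀ m, ∃ S : List Bool, S.length ≤ 3 * (m + 1) * m ∧ (Good m → ∀ x : List Bool,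
      x.length = m → ∃ i ≤ S.length, ∃ r : Fin (ℓ.eval (N m)) → Bool, D.draw (N m) r ∈ L ∧
        (shift x (S.drop i)).take (ℓ.eval (N m)) = List.ofFn r) := by
    intro m
    by_cases hm : Good m
    · obtain ⟨S, hS, h⟩ := exists_shifts _ hm.2
      refine ⟨S, ?_, fun _ x hx => ?_⟩
      · rw [hS]
        have := hm.1
        gcongr
      · obtain ⟨i, hi, r, hr, e⟩ := h x (by rw [hx]; exact hm.1)
        exact ⟨i, hi, r, (Finset.mem_filter.1 hr).2, e⟩
    · exact ⟨[], by simp, fun h => (hm h).elim⟩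
  choose S hSlen hS using hS
  let adv : ℕ → List Bool := fun m => pairBits (if Good m then [] else [true]) <|
    pairBits (List.replicate (N m) true) <| pairBits (List.replicate (ℓ.eval (N m)) true) <|
    pairBits (List.replicate (q.eval (N m)) true) (S m)
  have hadv : PolyAdvice adv := by
    refine ⟨2 * Polynomial.X + 2 * ℓ + 2 * q + 3 * (Polynomial.X + 1) * Polynomial.X + 10,
      fun m => ?_⟩
    have h₁ : (if Good m then [] else [true] : List Bool).length ≤ 1 := by split_ifs <;> simp
    have h₂ : N m ≤ m := seedParam_le ℓ m
    have h₃ := eval_mono_nat ℓ h₂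
    have h₄ := eval_mono_nat q h₂
    have h₅ := hSlen m
    simp only [adv, length_pairBits, List.length_replicate]
    simp only at h₃ h₄
    simp
    omega
  -- A solution pairs a unary position `i` with a witness `w` and has length `2 * i + 1 + w.length`,
  -- where `i ≤ 3 * (m + 1) * m`.
  let q' : Polynomial ℕ := 6 * (Polynomial.X + 1) * Polynomial.X + q + 1
  have hacc : ∀ (m : ℕ) (x w : List Bool), shiftVerifier V D.sample ![adv m, x, w] = [true] ↔
      (¬ Good m ∨ V ![D.sample ![List.replicate (N m) true,
        (shift x ((S m).drop (fstBits w).length)).take (ℓ.eval (N m))],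
          (sndBits w).take (q.eval (N m))] = [true]) := by
    intro m x w
    by_cases hm : Good m <;> simp [shiftVerifier, anyTrue_two, adv, hm]
  let R : List Bool → List Bool → Prop := fun x w => w.length ≤ q'.eval x.length ∧
    shiftVerifier V D.sample ![adv x.length, x, w] = [true]
  refine ⟨R, ⟨⟨_, adv, q', polyTime_shiftVerifier hVt D.polyTime, hadv, fun _ _ => Iff.rfl⟩, ?_⟩,
    uniformSampler, ?_⟩
  · intro x
    by_cases hm : Good x.length
    · obtain ⟨i, hi, r, hr, e⟩ := hS _ hm x rfl
      obtain ⟨w, hw, hVw⟩ := (hV _).1 hr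
      have hlen : (D.draw (N x.length) r).length = N x.length := D.length_sample _ _ (by simp)
      rw [hlen] at hw
      refine ⟨pairBits (List.replicate i true) w, ?_, (hacc _ _ _).2 (Or.inr ?_)⟩
      · have h₁ := eval_mono_nat q (seedParam_le ℓ x.length)
        have h₂ := hSlen x.length
        simp only at h₁
        simp only [length_pairBits, List.length_replicate, q', Polynomial.eval_add,
          Polynomial.eval_mul, Polynomial.eval_X, Polynomial.eval_one, Polynomial.eval_ofNat]
        have h₃ : 2 * (3 * (x.length + 1) * x.length) = 6 * (x.length + 1) * x.length := by ring
        have h₄ : w.length ≤ q.eval x.length := hw.trans h₁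
        omega
      · rw [fstBits_pairBits, sndBits_pairBits, List.length_replicate, e, List.take_of_length_le hw]
        exact hVw
    · exact ⟨[], by simp, (hacc _ _ _).2 (Or.inl hm)⟩
  · intro A a coins hA ⟨qa, hqa⟩ c
    by_contra hbad
    rw [Filter.not_eventually] at hbad
    simp only [not_lt] at hbad
    let E : ∀ m, Finset ((Fin (uniformSampler.seedLen.eval m) → Bool) ×
        (Fin (coins.eval m) → Bool)) := fun m => Finset.univ.filter fun ω =>
      R (List.ofFn ω.1) (A ![a m, List.ofFn ω.1, List.ofFn ω.1, List.ofFn ω.2])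
    have hlenU : ∀ m, uniformSampler.seedLen.eval m = m := fun m => Polynomial.eval_X
    have hred : ∀ m, Good m → ∃ adv : List Bool,
        adv.length = 2 * (a m).length + 2 * m + 2 * coins.eval m + 2 * q.eval (N m) + 5 ∧
        (1 / 2 + ((E m).card : ℝ) / (2 ^ m * 2 ^ coins.eval m) / (2 * ((S m).length + 1)) : ℝ) ≤
          prob fun ω : (Fin (ℓ.eval (N m)) → Bool) × (Fin ((0 : Polynomial ℕ).eval (N m)) → Bool) =>
            (shiftDecider V A ![adv, List.ofFn ω.1, D.draw (N m) ω.1, List.ofFn ω.2] = [true] ↔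
              D.draw (N m) ω.1 ∈ L) := by
      intro m hm
      have := exists_advice_shiftDecider hV D (n := N m) (hm.1.trans (hlenU m).ge) (S m) (a m) A
        (E m) (by
          intro ω hω
          have h₁ := (Finset.mem_filter.1 hω).2.2
          have h₂ : adv (List.ofFn ω.1).length = adv m := by rw [List.length_ofFn, hlenU]
          rw [h₂, hacc] at h₁
          exact h₁.resolve_left (not_not.2 hm))
      -- The type of `E m` mentions the seed length, which can be rewritten to `m` once only the
      -- cardinality is left.
      generalize (E m).card = e at this ⊢
      rw [hlenU] at this
      exact this
    let Bad : ℕ → Prop := fun m => (1 : ℝ) / (m : ℝ) ^ c ≤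
      (E m).card / (2 ^ m * 2 ^ coins.eval m)
    have hbad' : ∃ᶠ m in Filter.atTop, Bad m := by
      refine hbad.mono fun m hm => hm.trans (le_of_eq ?_)
      unfold prob
      have hc : Fintype.card ((Fin (uniformSampler.seedLen.eval m) → Bool) ×
          (Fin (coins.eval m) → Bool)) = 2 ^ m * 2 ^ coins.eval m := by
        simp [hlenU]
      rw [hc]
      push_cast
      congr!
    -- the bound on the instance length in terms of the parameter
    let M : Polynomial ℕ := Polynomial.X + ℓ.comp (Polynomial.X + 1)
    have hM : ∀ m, m ≤ M.eval (N m) := by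
      intro m
      simpa [M] using le_eval_seedParam ℓ m
    -- The inverse advantage `2 * ((S m).length + 1) * m ^ c`, with `m` bounded by `M` at the
    -- parameter.
    let K : Polynomial ℕ := 2 * (3 * (M + 1) * M + 1) * M ^ c
    -- Several lengths can share the parameter `n`. The advice for `n` is built from one bad length
    -- among them, if there is one.
    have hex : ∀ n, ∃ adv : List Bool,
        adv.length ≤ ((2 * qa + 2 * Polynomial.X + 2 * coins).comp M + 2 * q + 5).eval n ∧
        ((∃ m, 0 < m ∧ N m = n ∧ Good m ∧ Bad m) → (1 / 2 + 1 / ((K.eval n : ℕ) : ℝ) : ℝ) ≤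
          prob fun ω : (Fin (ℓ.eval n) → Bool) × (Fin ((0 : Polynomial ℕ).eval n) → Bool) =>
            (shiftDecider V A ![adv, List.ofFn ω.1, D.draw n ω.1, List.ofFn ω.2] = [true] ↔
              D.draw n ω.1 ∈ L)) := by
      intro n
      by_cases hn : ∃ m, 0 < m ∧ N m = n ∧ Good m ∧ Bad m
      · obtain ⟨m, hm, rfl, hg, hb⟩ := hn
        obtain ⟨adv, hlen, hp⟩ := hred m hg
        refine ⟨adv, ?_, fun _ => le_trans ?_ hp⟩
        · have h₁ := eval_mono_nat (2 * qa + 2 * Polynomial.X + 2 * coins) (hM m)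
          have h₂ := hqa m
          simp only [Polynomial.eval_add, Polynomial.eval_mul, Polynomial.eval_X,
            Polynomial.eval_ofNat, Polynomial.eval_comp] at h₁ ⊢
          omega
        · refine add_le_add_right ?_ _
          have h₁ : 2 * ((S m).length + 1) * m ^ c ≤ K.eval (N m) := by
            have h₂ : (S m).length ≤ 3 * (M.eval (N m) + 1) * M.eval (N m) := by
              have := hM m
              exact (hSlen m).trans (by gcongr)
            simp only [K, Polynomial.eval_mul, Polynomial.eval_add, Polynomial.eval_pow,
              Polynomial.eval_ofNat, Polynomial.eval_one]
            have := hM m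
            gcongr
          calc (1 : ℝ) / ((K.eval (N m) : ℕ) : ℝ) ≤ 1 / (2 * ((S m).length + 1) * m ^ c) := by
                refine one_div_le_one_div_of_le (by positivity) ?_
                exact_mod_cast h₁
            _ = 1 / (m : ℝ) ^ c / (2 * ((S m).length + 1)) := by
                rw [div_div, mul_comm]
            _ ≤ _ := by
                gcongr
      · exact ⟨[], by simp, fun h => (hn h).elim⟩
    choose advD hlenD hprobD using hex
    obtain ⟨c', hc'⟩ := exists_eval_le_pow K
    have hev := hD (shiftDecider V A) advD 0 (polyTime_shiftDecider hVt hA) ⟨_, hlenD⟩ c'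
    -- As `N` tends to infinity, what holds for all large parameters holds at `N m` for all large
    -- `m`, hence at some bad `m`.
    obtain ⟨m, hb, hg, hlt, h2, hm⟩ := (hbad'.and_eventually (hGood.and
      (((tendsto_seedParam ℓ).eventually hev).and
        (((tendsto_seedParam ℓ).eventually (Filter.eventually_ge_atTop 2)).and
          (Filter.eventually_gt_atTop 0))))).exists
    have hle := hprobD (N m) ⟨m, hm, rfl, hg, hb⟩
    have hK : 0 < K.eval (N m) := by
      have : 0 < M.eval (N m) := hm.trans_le (hM m)
      simp only [K, Polynomial.eval_mul, Polynomial.eval_add, Polynomial.eval_pow,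
        Polynomial.eval_ofNat, Polynomial.eval_one]
      positivity
    have hKc : (1 : ℝ) / ((N m : ℕ) : ℝ) ^ c' ≤ 1 / ((K.eval (N m) : ℕ) : ℝ) := by
      refine one_div_le_one_div_of_le (by exact_mod_cast hK) ?_
      exact_mod_cast hc' (N m) h2
    have := hle.trans_lt hlt
    change _ < 1 / 2 + 1 / ((N m : ℕ) : ℝ) ^ c' at this
    linarith
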